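/- Let $A$ be a finite set and let $\mathcal{A}$ be a constraint language on $A$, i.e. a relational structure with domain $A$ and finitely or infinitely many relation symbols (each written in instances by a fixed distinct code word), possibly with constants naming some elements of $A$. $\mathrm{QCSP}(\mathcal{A})$ asks whether a given prenex positive Horn sentence (built with $\forall,\exists,\wedge,=$ from the symbols of $\mathcal{A}$) holds in $\mathcal{A}$; $\mathrm{CSP}(\mathcal{A})$ is its restriction to sentences without $\forall$; $\mathrm{QCSP}_c(\mathcal{A})$ and $\mathrm{CSP}_c(\mathcal{A})$ are the versions in which constants naming all the elements of $A$ may appear in instances. An adversary of length $m$ is a set $\mathscr{B}\subseteq A^m$. Let $\mathbf{\Omega}=(\Omega_m)_{m\ge 1}$ be a sequence such that each $\Omega_m$ is a set of adversaries of length $m$, and let $\mathrm{width}(\Omega_m)=\sum_{\mathscr{B}\in\Omega_m}|\mathscr{B}|$. Assume: 1. (non-degenerate) for all $m\ge 1$ and all $i\ne j$ in $\{1,\dots,m\}$ there are $\mathscr{B}\in\Omega_m$ and $t\in\mathscr{B}$ with $t_i\ne t_j$; 2. (effective) there are a polynomial $p'$ and an algorithm that, for every $m\ge 1$, given $m$ (in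 unary), outputs $\Omega_m$ (as a list of lists of tuples) in time at most $p'(\mathrm{width}(\Omega_m))$; 3. (projective) with $n=|A|$, for every $m\ge 1$ and every $\mathscr{B}\in\Omega_{n\cdot m}$ there is $\mathscr{B}'\in\Omega_m$ that contains, for every choice of one coordinate in each of the $m$ consecutive blocks of $n$ coordinates, the projection of $\mathscr{B}$ to the $m$ chosen coordinates; 4. (polynomially bounded) there is a polynomial $p$ with $\mathrm{width}(\Omega_m)\le p(m)$ for all $m\ge 1$; 5. ($\Omega_m$ generates $A^m$) for every $m\ge 1$ and every $t\in A^m$ there are a polymorphism $f$ of $\mathcal{A}$ (an operation preserving all relations and all constants of $\mathcal{A}$), of some arity $k$, and tuples $t_1,\dots,t_k\in\bigcup\Omega_m$ such that $f(t_1,\dots,t_k)=t$, with $f$ applied coordinatewise. Then for every expansion $\mathcal{A}'$ of $\mathcal{A}$ by constants naming elements of $A$ such that every element occurring in a tuple of an adversary in some $\Omega_m$, $m\ge 1$, is named by a constant of $\mathcal{A}'$, the problem $\mathrm{QCSP}(\mathcal{A})$ reduces in polynomial time (many-one) to $\mathrm{CSP}(\mathcal{A}')$. In particular, if $\mathcal{A}$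 has constants naming all elements of $A$, then $\mathrm{QCSP}_c(\mathcal{A})$ reduces in polynomial time to $\mathrm{CSP}_c(\mathcal{A})$. -/

import Mathlib

/-! ### Polynomial time: structured multi-stack programs with a step count -/

/-- Programs of a multi-stack machine. The registers are indexed by natural numbers and each
holds a stack of bits (a program mentions only finitely many of them). The only operations are
pushing a fixed bit, popping, branching on the top of a stack and looping while a stack is
nonempty; every operation inspects or changes only the top of one stack. -/
inductive Prog : Type where
  | skip : Prog
  | push (r : ℕ) (b : Bool) : Prog
  | pop (r : ℕ) : Prog
  | seq (p q : Prog) : Prog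
  | branch (r : ℕ) (ifEmpty ifFalse ifTrue : Prog) : Prog
  | loop (r : ℕ) (body : Prog) : Prog

/-- The contents of all registers; the head of a list is the top of the stack. -/
abbrev Store : Type := ℕ → List Bool

/-- `Exec p s t s'`: started on the store `s`, the program `p` halts after exactly `t` steps
with the store `s'`. Every push, pop, skip and every test of a stack counts as one step. -/
inductive Exec : Prog → Store → ℕ → Store → Prop where
  | skip (s : Store) : Exec Prog.skip s 1 s
  | push (r : ℕ) (b : Bool) (s : Store) :
      Exec (Prog.push r b) s 1 (Function.update s r (b :: s r))
  | pop (r : ℕ) (s : Store) :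
      Exec (Prog.pop r) s 1 (Function.update s r (s r).tail)
  | seq {p q : Prog} {s s₁ s₂ : Store} {t₁ t₂ : ℕ} :
      Exec p s t₁ s₁ → Exec q s₁ t₂ s₂ → Exec (Prog.seq p q) s (t₁ + t₂) s₂
  | branchEmpty {r : ℕ} {p₀ p₁ p₂ : Prog} {s s₁ : Store} {t : ℕ} :
      s r = [] → Exec p₀ s t s₁ → Exec (Prog.branch r p₀ p₁ p₂) s (t + 1) s₁
  | branchFalse {r : ℕ} {p₀ p₁ p₂ : Prog} {s s₁ : Store} {t : ℕ} :
      (s r).head? = some false → Exec p₁ s t s₁ → Exec (Prog.branch r p₀ p₁ p₂) s (t + 1) s₁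
  | branchTrue {r : ℕ} {p₀ p₁ p₂ : Prog} {s s₁ : Store} {t : ℕ} :
      (s r).head? = some true → Exec p₂ s t s₁ → Exec (Prog.branch r p₀ p₁ p₂) s (t + 1) s₁
  | loopDone {r : ℕ} {p : Prog} {s : Store} :
      s r = [] → Exec (Prog.loop r p) s 1 s
  | loopStep {r : ℕ} {p : Prog} {s s₁ s₂ : Store} {t₁ t₂ : ℕ} :
      s r ≠ [] → Exec p s t₁ s₁ → Exec (Prog.loop r p) s₁ t₂ s₂ →
        Exec (Prog.loop r p) s (t₁ + t₂ + 1) s₂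

/-- On input `x` (in register `0`, all other registers empty) the program `p` halts within `T`
steps with the word `y` in register `0`. -/
def OutputsWithin (p : Prog) (x y : List Bool) (T : ℕ) : Prop :=
  ∃ t ≤ T, ∃ s : Store, Exec p (Function.update (fun _ => []) 0 x) t s ∧ s 0 = y

/-! ### Encoding of instances as words -/

/-- `n` in unary, with an end marker. -/
def encNat (n : ℕ) : List Bool := List.replicate n true ++ [false]

/-- A list of objects, each preceded by `true`, with the end marker `false`. -/
def encList {α : Type} (enc : α → List Bool) : List α → List Bool
  | [] => [false]
  | x :: l => true :: (enc x ++ encList enc l)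

/-- A self-delimiting code for words. -/
def encWord (w : List Bool) : List Bool := encList (fun b => [b]) w

/-- Self-delimiting codes: an encoded object can be read off from the front of a word. -/
def SelfDelimiting {α : Type} (enc : α → List Bool) : Prop :=
  ∀ x y u v, enc x ++ u = enc y ++ v → x = y ∧ u = v

theorem selfDelimiting_encNat : SelfDelimiting encNat := by
  intro x
  induction x with
  | zero => intro y u v h; cases y <;> simp_all [encNat, List.replicate_succ]
  | succ n ih =>
    intro y u v h
    cases y with
    | zero => simp [encNat, List.replicate_succ] at h
    | succ k =>
      have := ih k u v (by simpa [encNat, List.replicate_succ] using h)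
      simpa using this

theorem selfDelimiting_encList {α : Type} {enc : α → List Bool} (h : SelfDelimiting enc) :
    SelfDelimiting (encList enc) := by
  intro x
  induction x with
  | nil => intro y u v e; cases y <;> simp_all [encList]
  | cons a l ih =>
    intro y u v e
    cases y with
    | nil => simp [encList] at e
    | cons b k =>
      simp only [encList, List.cons_append, List.append_assoc, List.cons.injEq, true_and] at e
      obtain ⟨rfl, e₁⟩ := h _ _ _ _ e
      obtain ⟨rfl, e₂⟩ := ih _ _ _ e₁
      exact ⟨rfl, e₂⟩

theorem selfDelimiting_encWord : SelfDelimiting encWord :=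
  selfDelimiting_encList (by intro x y u v e; simpa using e)

/-! ### Decision problems and polynomial-time reductions -/

/-- A decision problem: instances, written as words over `{0,1}`, and the yes-instances. -/
structure DecisionProblem : Type 1 where
  Inst : Type
  encode : Inst → List Bool
  encode_injective : Function.Injective encode
  yes : Inst → Prop

/-- Polynomial-time many-one reducibility. -/
def DecisionProblem.PolyReducesTo (P Q : DecisionProblem) : Prop :=
  ∃ (f : P.Inst → Q.Inst) (prog : Prog) (q : Polynomial ℕ),
    (∀ x, OutputsWithin prog (P.encode x) (Q.encode (f x)) (q.eval (P.encode x).length)) ∧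
    ∀ x, P.yes x ↔ Q.yes (f x)

/-! ### Constraint languages, positive Horn sentences, CSP and QCSP -/

/-- A constraint language on the domain `A`: finitely or infinitely many relation symbols,
interpreted by relations on `A`, and constants naming some of the elements of `A`. The word
`symCode R` is what is written in an instance for the relation symbol `R`. -/
structure ConstraintLanguage (A : Type) : Type 1 where
  Sym : Type
  arity : Sym → ℕ
  rel : (R : Sym) → Set (Fin (arity R) → A)
  symCode : Sym → List Bool
  symCode_injective : Function.Injective symCode
  consts : Set A

/-- The expansion by constants naming the elements of `C`. -/
def ConstraintLanguage.withConstants {A : Type} (L : ConstraintLanguage A) (C : Set A) :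
    ConstraintLanguage A :=
  { L with consts := L.consts ∪ C }

inductive Quantifier : Type where
  | all
  | ex

/-- Terms over the variables `0, …, n - 1`: variables and constants. -/
inductive CTerm {A : Type} (L : ConstraintLanguage A) (n : ℕ) : Type where
  | var (i : Fin n)
  | const (a : A) (h : a ∈ L.consts)

/-- Atomic formulas over the variables `0, …, n - 1`. -/
inductive CAtom {A : Type} (L : ConstraintLanguage A) (n : ℕ) : Type where
  | eq (s t : CTerm L n)
  | rel (R : L.Sym) (args : Fin (L.arity R) → CTerm L n)

/-- Positive Horn sentences in prenex form: the variables `0, …, numVars - 1` are quantified in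
this order, and the quantifier-free part is the conjunction of the atoms in `matrix`. -/
structure PHSentence {A : Type} (L : ConstraintLanguage A) : Type where
  numVars : ℕ
  quant : Fin numVars → Quantifier
  matrix : List (CAtom L numVars)

section Semantics

variable {A : Type} {L : ConstraintLanguage A} {n : ℕ}

def CTerm.value (v : Fin n → A) : CTerm L n → A
  | .var i => v i
  | .const a _ => a

def CAtom.Holds (v : Fin n → A) : CAtom L n → Prop
  | .eq s t => s.value v = t.value v
  | .rel R args => (fun i => (args i).value v) ∈ L.rel R

/-- `Q₀ x₀ ∈ A, …, Qₙ₋₁ xₙ₋₁ ∈ A, P (x₀, …, xₙ₋₁)`. -/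
def PrefixHolds : (n : ℕ) → (Fin n → Quantifier) → ((Fin n → A) → Prop) → Prop
  | 0, _, P => P Fin.elim0
  | n + 1, q, P =>
    match q 0 with
    | .all => ∀ a : A, PrefixHolds n (Fin.tail q) (fun v => P (Fin.cons a v))
    | .ex => ∃ a : A, PrefixHolds n (Fin.tail q) (fun v => P (Fin.cons a v))

/-- Truth of a positive Horn sentence in the structure. -/
def PHSentence.Holds (φ : PHSentence L) : Prop :=
  PrefixHolds φ.numVars φ.quant (fun v => ∀ α ∈ φ.matrix, α.Holds v)

/-- Primitive positive sentences: only existential quantifiers. -/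
def PHSentence.IsPrimitivePositive (φ : PHSentence L) : Prop :=
  ∀ i, φ.quant i = Quantifier.ex

end Semantics

section Encoding

variable {A : Type} [Fintype A]

/-- Elements of the finite domain are written by their number in a fixed enumeration. -/
noncomputable def encElem (a : A) : List Bool := encNat (Fintype.equivFin A a)

theorem selfDelimiting_encElem : SelfDelimiting (encElem (A := A)) := by
  intro x y u v e
  obtain ⟨h, rfl⟩ := selfDelimiting_encNat _ _ _ _ e
  exact ⟨(Fintype.equivFin A).injective (Fin.ext h), rfl⟩

variable {L : ConstraintLanguage A} {n : ℕ}

noncomputable def CTerm.encode : CTerm L n → List Bool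
  | .var i => false :: encNat i
  | .const a _ => true :: encElem a

noncomputable def CAtom.encode : CAtom L n → List Bool
  | .eq s t => false :: (s.encode ++ t.encode)
  | .rel R args => true :: (encWord (L.symCode R) ++ encList CTerm.encode (List.ofFn args))

def Quantifier.encode : Quantifier → List Bool
  | .all => [true]
  | .ex => [false]

noncomputable def PHSentence.encode (φ : PHSentence L) : List Bool :=
  encList Quantifier.encode (List.ofFn φ.quant) ++ encList CAtom.encode φ.matrix

theorem CTerm.selfDelimiting_encode : SelfDelimiting (CTerm.encode (L := L) (n := n)) := by
  intro x y u v e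
  cases x <;> cases y <;> simp only [CTerm.encode, List.cons_append, List.cons.injEq,
    true_and, reduceCtorEq, false_and] at e
  · obtain ⟨h, rfl⟩ := selfDelimiting_encNat _ _ _ _ e
    exact ⟨by rw [Fin.ext h], rfl⟩
  · obtain ⟨rfl, rfl⟩ := selfDelimiting_encElem _ _ _ _ e
    exact ⟨rfl, rfl⟩

theorem CAtom.selfDelimiting_encode : SelfDelimiting (CAtom.encode (L := L) (n := n)) := by
  intro x y u v e
  cases x <;> cases y <;> simp only [CAtom.encode, List.cons_append, List.cons.injEq,
    true_and, reduceCtorEq, false_and, List.append_assoc] at e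
  · obtain ⟨rfl, e₁⟩ := CTerm.selfDelimiting_encode _ _ _ _ e
    obtain ⟨rfl, rfl⟩ := CTerm.selfDelimiting_encode _ _ _ _ e₁
    exact ⟨rfl, rfl⟩
  · obtain ⟨h, e⟩ := selfDelimiting_encWord _ _ _ _ e
    obtain rfl := L.symCode_injective h
    obtain ⟨h, rfl⟩ := selfDelimiting_encList CTerm.selfDelimiting_encode _ _ _ _ e
    obtain rfl := List.ofFn_injective h
    exact ⟨rfl, rfl⟩

theorem PHSentence.encode_injective : Function.Injective (PHSentence.encode (L := L)) := by
  rintro ⟨n, q, M⟩ ⟨n', q', M'⟩ e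
  have hq : SelfDelimiting Quantifier.encode := by
    intro x y u v e
    cases x <;> cases y <;> simp_all [Quantifier.encode]
  obtain ⟨h, e⟩ := selfDelimiting_encList hq _ _ _ _ e
  obtain rfl : n = n' := by simpa using congrArg List.length h
  obtain rfl := List.ofFn_injective h
  obtain ⟨rfl, -⟩ := selfDelimiting_encList CAtom.selfDelimiting_encode M M' [] []
    (by simpa using e)
  rfl

end Encoding

section Problems

variable {A : Type} [Fintype A]

/-- Given a positive Horn sentence, does it hold in the constraint language? -/
noncomputable def QCSP (L : ConstraintLanguage A) : DecisionProblem where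
  Inst := PHSentence L
  encode := PHSentence.encode
  encode_injective := PHSentence.encode_injective
  yes := PHSentence.Holds

/-- Given a primitive positive sentence, does it hold in the constraint language? -/
noncomputable def CSP (L : ConstraintLanguage A) : DecisionProblem where
  Inst := {φ : PHSentence L // φ.IsPrimitivePositive}
  encode φ := φ.1.encode
  encode_injective := PHSentence.encode_injective.comp Subtype.val_injective
  yes φ := φ.1.Holds

/-- The version of QCSP in which constants naming all elements may appear in instances. -/
noncomputable def QCSPc (L : ConstraintLanguage A) : DecisionProblem :=
  QCSP (L.withConstants Set.univ)

/-- The version of CSP in which constants naming all elements may appear in instances. -/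
noncomputable def CSPc (L : ConstraintLanguage A) : DecisionProblem :=
  CSP (L.withConstants Set.univ)

end Problems

/-! ### Adversaries -/

/-- The `k`-ary operation `f` is a polymorphism: it preserves all relations and all constants. -/
def IsPolymorphism {A : Type} (L : ConstraintLanguage A) {k : ℕ} (f : (Fin k → A) → A) : Prop :=
  (∀ (R : L.Sym) (t : Fin k → Fin (L.arity R) → A), (∀ j, t j ∈ L.rel R) →
    (fun i => f (fun j => t j i)) ∈ L.rel R) ∧
  ∀ a ∈ L.consts, f (fun _ => a) = a

/-- An adversary of length `m` on the finite set `A` is an `m`-ary relation on `A`. -/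
abbrev Adversary (A : Type) (m : ℕ) : Type := Finset (Fin m → A)

/-- `Ω` generates the adversary `𝒪`: every tuple of `𝒪` is the image, under a polymorphism
applied coordinatewise, of tuples that belong to adversaries in `Ω`. -/
def Generates {A : Type} (L : ConstraintLanguage A) {m : ℕ} (Ω : Finset (Adversary A m))
    (𝒪 : Set (Fin m → A)) : Prop :=
  ∀ t ∈ 𝒪, ∃ (k : ℕ) (f : (Fin k → A) → A) (s : Fin k → Fin m → A),
    IsPolymorphism L f ∧ (∀ j, ∃ B ∈ Ω, s j ∈ B) ∧ ∀ i, f (fun j => s j i) = t i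

/-- The constants `c₁, …, cₘ` of the product, over all adversaries of `Ω` and all their tuples
`μ`, of the structures in which `cᵢ` is interpreted as `μ i`, are pairwise distinct. -/
def Nondegenerate {A : Type} {m : ℕ} (Ω : Finset (Adversary A m)) : Prop :=
  ∀ i j : Fin m, i ≠ j → ∃ B ∈ Ω, ∃ μ ∈ B, μ i ≠ μ j

/-- The sum of the sizes of the adversaries in `Ω`. -/
def width {A : Type} {m : ℕ} (Ω : Finset (Adversary A m)) : ℕ := ∑ B ∈ Ω, B.card

def PolynomiallyBounded {A : Type} (Ω : (m : ℕ) → Finset (Adversary A m)) : Prop :=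
  ∃ p : Polynomial ℕ, ∀ m ≥ 1, width (Ω m) ≤ p.eval m

/-- With `n` the number of elements of `A`: for every `B` in `Ω (m * n)` there is an adversary in
`Ω m` that contains every projection of `B` to `m` coordinates, one in each of the `m`
consecutive blocks of `n` coordinates (coordinate `i` of block `j` is
`finProdFinEquiv (j, i) = i + n * j`). -/
def Projective {A : Type} [Fintype A] (Ω : (m : ℕ) → Finset (Adversary A m)) : Prop :=
  ∀ m ≥ 1, ∀ B ∈ Ω (m * Fintype.card A), ∃ B' ∈ Ω m, ∀ i : Fin m → Fin (Fintype.card A),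
    ∀ t ∈ B, (fun j => t (finProdFinEquiv (j, i j))) ∈ B'

/-- `l` lists the adversaries in `Ω`, each given by a list of its tuples. -/
def ListsAdversaries {A : Type} {m : ℕ} (l : List (List (Fin m → A)))
    (Ω : Finset (Adversary A m)) : Prop :=
  ∀ B : Adversary A m, B ∈ Ω ↔ ∃ b ∈ l, ∀ t, t ∈ B ↔ t ∈ b

/-- A program outputs on input `m` (in unary), for every `m ≥ 1`, a list of the adversaries in
`Ω m`, in time polynomial in the width of `Ω m`. -/
def Effective {A : Type} [Fintype A] (Ω : (m : ℕ) → Finset (Adversary A m)) : Prop :=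
  ∃ (p' : Polynomial ℕ) (prog : Prog), ∀ m ≥ 1, ∃ l : List (List (Fin m → A)),
    ListsAdversaries l (Ω m) ∧
    OutputsWithin prog (List.replicate m true)
      (encList (encList (fun t => encList encElem (List.ofFn t))) l)
      (p'.eval (width (Ω m)))

/-! ### A calculus for programs -/

-- Truth of a quantified sentence means that the existential player has a strategy: a map from
-- opponent moves to values of all variables, where each value depends only on earlier moves. The
-- target sentence describes such a strategy on finitely many opponent plays only, namely the tuples
-- occurring in the adversaries of $\Omega_m$. Each tuple $T_g$ gets its own copy of the variables.
-- In copy $g$ the universal variables are equated with the constants $T_g(i)$, and the matrix is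
-- repeated. Copies $g$ and $g'$ share the value of variable $i$ whenever $T_g$ and $T_{g'}$ agree
-- up to coordinate $i$, which expresses causality.
--
-- A strategy against all plays clearly restricts to these. For the converse
-- (`holds_iff_exists_assignment`), take the tuple of length $m\cdot|A|$ in which each of the $m$
-- blocks enumerates $A$. It is $f(s_1,\dots,s_k)$ for a polymorphism $f$ and tuples $s_l$ from
-- $\Omega_{m|A|}$. For a play $x\in A^m$, projecting $s_l$ to position $x_i$ in block $i$ gives, by
-- projectivity, a tuple of $\Omega_m$, and $f$ maps these $k$ projections to $x$. Answer $x$ by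
-- applying $f$ to the $k$ recorded answers. Coordinate $j$ of each projection depends only on
-- $x_j$, so the shared values make the combined strategy causal. One $f$ serves all plays at once,
-- and being a polymorphism it preserves the matrix.
--
-- With $n$ variables in the sentence, $m=n+1$: a dummy last coordinate keeps the length positive
-- when there are no variables.
--
-- The rest is complexity. An explicit stack program runs the given enumeration of $\Omega_m$ on
-- registers of its own and writes the target sentence (`outputsWithin_reduction`). One number $M$
-- bounds the input length, $m$ and the enumeration time. A register grows by at most one bit per
-- step, so $M$ also bounds the code of $\Omega_m$, hence every loop length, and each cost is a
-- polynomial in $M$. The assumption on the width makes $M$ polynomial in the input length.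

infixr:60 " ;; " => Prog.seq

/-- Started on `s`, the program `p` halts, and the number of steps and the final store
satisfy `Q`. -/
def Wp (p : Prog) (s : Store) (Q : ℕ → Store → Prop) : Prop :=
  ∃ t s', Exec p s t s' ∧ Q t s'

/-- Started on `s`, the program `p` halts within `T` steps with the store `s'`. -/
def Runs (p : Prog) (s : Store) (T : ℕ) (s' : Store) : Prop :=
  Wp p s fun t s₁ => t ≤ T ∧ s₁ = s'

/-- The consequence rule by which verified subprograms are chained: the final store is known exactly
and the time only through a bound, so the continuation is checked for every `t ≤ T`. -/
theorem Runs.wp {p : Prog} {s s' : Store} {T : ℕ} {Q : ℕ → Store → Prop} (h : Runs p s T s')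
    (hQ : ∀ t ≤ T, Q t s') : Wp p s Q := by
  obtain ⟨t, s₁, h, ht, rfl⟩ := h
  exact ⟨t, s₁, h, hQ t ht⟩

theorem Runs.mono {p : Prog} {s s' : Store} {T T' : ℕ} (h : Runs p s T s') (hT : T ≤ T') :
    Runs p s T' s' :=
  h.wp fun _ ht => ⟨ht.trans hT, rfl⟩

@[simp] theorem wp_skip {s : Store} {Q : ℕ → Store → Prop} : Wp Prog.skip s Q ↔ Q 1 s :=
  ⟨by rintro ⟨_, _, ⟨⟩, h⟩; exact h, fun h => ⟨_, _, .skip s, h⟩⟩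

@[simp] theorem wp_push {r : ℕ} {b : Bool} {s : Store} {Q : ℕ → Store → Prop} :
    Wp (Prog.push r b) s Q ↔ Q 1 (Function.update s r (b :: s r)) :=
  ⟨by rintro ⟨_, _, ⟨⟩, h⟩; exact h, fun h => ⟨_, _, .push r b s, h⟩⟩

@[simp] theorem wp_pop {r : ℕ} {s : Store} {Q : ℕ → Store → Prop} :
    Wp (Prog.pop r) s Q ↔ Q 1 (Function.update s r (s r).tail) :=
  ⟨by rintro ⟨_, _, ⟨⟩, h⟩; exact h, fun h => ⟨_, _, .pop r s, h⟩⟩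

@[simp] theorem wp_seq {p q : Prog} {s : Store} {Q : ℕ → Store → Prop} :
    Wp (p ;; q) s Q ↔ Wp p s fun t₁ s₁ => Wp q s₁ fun t₂ s₂ => Q (t₁ + t₂) s₂ := by
  constructor
  · rintro ⟨_, _, h, hQ⟩
    cases h with
    | seq h₁ h₂ => exact ⟨_, _, h₁, _, _, h₂, hQ⟩
  · rintro ⟨_, _, h₁, _, _, h₂, hQ⟩
    exact ⟨_, _, .seq h₁ h₂, hQ⟩

@[simp] theorem wp_branch {r : ℕ} {p₀ p₁ p₂ : Prog} {s : Store} {Q : ℕ → Store → Prop} :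
    Wp (Prog.branch r p₀ p₁ p₂) s Q ↔
      match s r with
      | [] => Wp p₀ s fun t => Q (t + 1)
      | false :: _ => Wp p₁ s fun t => Q (t + 1)
      | true :: _ => Wp p₂ s fun t => Q (t + 1) := by
  constructor
  · rintro ⟨_, _, h, hQ⟩
    cases h with
    | branchEmpty e h => rw [e]; exact ⟨_, _, h, hQ⟩
    | branchFalse e h =>
      obtain ⟨l, e⟩ := List.head?_eq_some_iff.1 e
      rw [e]; exact ⟨_, _, h, hQ⟩
    | branchTrue e h =>
      obtain ⟨l, e⟩ := List.head?_eq_some_iff.1 e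
      rw [e]; exact ⟨_, _, h, hQ⟩
  · rcases e : s r with _ | ⟨_ | _, l⟩
    · rintro ⟨_, _, h, hQ⟩; exact ⟨_, _, .branchEmpty e h, hQ⟩
    · rintro ⟨_, _, h, hQ⟩; exact ⟨_, _, .branchFalse (by simp [e]) h, hQ⟩
    · rintro ⟨_, _, h, hQ⟩; exact ⟨_, _, .branchTrue (by simp [e]) h, hQ⟩

theorem wp_loop_of_eq_nil {r : ℕ} {p : Prog} {s : Store} {Q : ℕ → Store → Prop} (h : s r = [])
    (hQ : Q 1 s) : Wp (Prog.loop r p) s Q :=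
  ⟨_, _, .loopDone h, hQ⟩

theorem wp_loop_of_ne_nil {r : ℕ} {p : Prog} {s : Store} {Q : ℕ → Store → Prop} (h : s r ≠ [])
    (hQ : Wp p s fun t₁ s₁ => Wp (Prog.loop r p) s₁ fun t₂ s₂ => Q (t₁ + t₂ + 1) s₂) :
    Wp (Prog.loop r p) s Q := by
  obtain ⟨_, _, h₁, _, _, h₂, hQ⟩ := hQ
  exact ⟨_, _, .loopStep h h₁ h₂, hQ⟩

/-- A register grows by at most one bit in each step. -/
theorem Exec.length_le {p : Prog} {s s' : Store} {t : ℕ} (h : Exec p s t s') (r : ℕ) :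
    (s' r).length ≤ (s r).length + t := by
  induction h with
  | skip s => omega
  | push r' b s => by_cases h : r = r' <;> simp [h]
  | pop r' s => by_cases h : r = r' <;> simp [h]; omega
  | seq _ _ ih₁ ih₂ => omega
  | branchEmpty _ _ ih => omega
  | branchFalse _ _ ih => omega
  | branchTrue _ _ ih => omega
  | loopDone _ => omega
  | loopStep _ _ _ ih₁ ih₂ => omega

/-! ### The registers of the reduction -/

/-- The contents of the registers `0, …, 21`. -/
structure Regs : Type where
  inp : List Bool := []
  out : List Bool := []
  tmp : List Bool := []
  quants : List Bool := []
  unit : List Bool := []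
  qscan : List Bool := []
  tuples : List Bool := []
  outer : List Bool := []
  inner : List Bool := []
  cur : List Bool := []
  scan : List Bool := []
  idx : List Bool := []
  idx2 : List Bool := []
  off : List Bool := []
  cntA : List Bool := []
  cntB : List Bool := []
  agree : List Bool := []
  flagA : List Bool := []
  flagB : List Bool := []
  flagC : List Bool := []
  flagD : List Bool := []
  aux : List Bool := []

/-- The store with the given contents of the registers `0, …, 21`, followed by the store `e`. -/
def Regs.store (R : Regs) (e : Store) : Store
  | 0 => R.inp
  | 1 => R.out
  | 2 => R.tmp
  | 3 => R.quants
  | 4 => R.unit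
  | 5 => R.qscan
  | 6 => R.tuples
  | 7 => R.outer
  | 8 => R.inner
  | 9 => R.cur
  | 10 => R.scan
  | 11 => R.idx
  | 12 => R.idx2
  | 13 => R.off
  | 14 => R.cntA
  | 15 => R.cntB
  | 16 => R.agree
  | 17 => R.flagA
  | 18 => R.flagB
  | 19 => R.flagC
  | 20 => R.flagD
  | 21 => R.aux
  | r + 22 => e r

namespace Regs

variable (R : Regs) (e : Store) (v : List Bool)

/-- Behind the simp lemmas for the single registers, which turn every write into a record update and
so allow symbolic execution by `simp`. -/
theorem update_store {R R' : Regs} {e : Store} {k : ℕ} {v : List Bool} (hk : R'.store e k = v)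
    (h : ∀ r, r ≠ k → R'.store e r = R.store e r) :
    Function.update (R.store e) k v = R'.store e := by
  funext r
  obtain rfl | hr := eq_or_ne r k
  · simp [hk]
  · rw [Function.update_of_ne hr, h r hr]

@[simp] theorem store_inp : R.store e 0 = R.inp := rfl
@[simp] theorem update_inp : Function.update (R.store e) 0 v = { R with inp := v }.store e :=
  update_store rfl fun r hr => by unfold store; split <;> first | rfl | contradiction

@[simp] theorem store_out : R.store e 1 = R.out := rfl
@[simp] theorem update_out : Function.update (R.store e) 1 v = { R with out := v }.store e :=
  update_store rfl fun r hr => by unfold store; split <;> first | rfl | contradiction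

@[simp] theorem store_tmp : R.store e 2 = R.tmp := rfl
@[simp] theorem update_tmp : Function.update (R.store e) 2 v = { R with tmp := v }.store e :=
  update_store rfl fun r hr => by unfold store; split <;> first | rfl | contradiction

@[simp] theorem store_quants : R.store e 3 = R.quants := rfl
@[simp] theorem update_quants : Function.update (R.store e) 3 v = { R with quants := v }.store e :=
  update_store rfl fun r hr => by unfold store; split <;> first | rfl | contradiction

@[simp] theorem store_unit : R.store e 4 = R.unit := rfl
@[simp] theorem update_unit : Function.update (R.store e) 4 v = { R with unit := v }.store e :=
  update_store rfl fun r hr => by unfold store; split <;> first | rfl | contradiction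

@[simp] theorem store_qscan : R.store e 5 = R.qscan := rfl
@[simp] theorem update_qscan : Function.update (R.store e) 5 v = { R with qscan := v }.store e :=
  update_store rfl fun r hr => by unfold store; split <;> first | rfl | contradiction

@[simp] theorem store_tuples : R.store e 6 = R.tuples := rfl
@[simp] theorem update_tuples : Function.update (R.store e) 6 v = { R with tuples := v }.store e :=
  update_store rfl fun r hr => by unfold store; split <;> first | rfl | contradiction

@[simp] theorem store_outer : R.store e 7 = R.outer := rfl
@[simp] theorem update_outer : Function.update (R.store e) 7 v = { R with outer := v }.store e :=
  update_store rfl fun r hr => by unfold store; split <;> first | rfl | contradiction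

@[simp] theorem store_inner : R.store e 8 = R.inner := rfl
@[simp] theorem update_inner : Function.update (R.store e) 8 v = { R with inner := v }.store e :=
  update_store rfl fun r hr => by unfold store; split <;> first | rfl | contradiction

@[simp] theorem store_cur : R.store e 9 = R.cur := rfl
@[simp] theorem update_cur : Function.update (R.store e) 9 v = { R with cur := v }.store e :=
  update_store rfl fun r hr => by unfold store; split <;> first | rfl | contradiction

@[simp] theorem store_scan : R.store e 10 = R.scan := rfl
@[simp] theorem update_scan : Function.update (R.store e) 10 v = { R with scan := v }.store e :=
  update_store rfl fun r hr => by unfold store; split <;> first | rfl | contradiction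

@[simp] theorem store_idx : R.store e 11 = R.idx := rfl
@[simp] theorem update_idx : Function.update (R.store e) 11 v = { R with idx := v }.store e :=
  update_store rfl fun r hr => by unfold store; split <;> first | rfl | contradiction

@[simp] theorem store_idx2 : R.store e 12 = R.idx2 := rfl
@[simp] theorem update_idx2 : Function.update (R.store e) 12 v = { R with idx2 := v }.store e :=
  update_store rfl fun r hr => by unfold store; split <;> first | rfl | contradiction

@[simp] theorem store_off : R.store e 13 = R.off := rfl
@[simp] theorem update_off : Function.update (R.store e) 13 v = { R with off := v }.store e :=
  update_store rfl fun r hr => by unfold store; split <;> first | rfl | contradiction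

@[simp] theorem store_cntA : R.store e 14 = R.cntA := rfl
@[simp] theorem update_cntA : Function.update (R.store e) 14 v = { R with cntA := v }.store e :=
  update_store rfl fun r hr => by unfold store; split <;> first | rfl | contradiction

@[simp] theorem store_cntB : R.store e 15 = R.cntB := rfl
@[simp] theorem update_cntB : Function.update (R.store e) 15 v = { R with cntB := v }.store e :=
  update_store rfl fun r hr => by unfold store; split <;> first | rfl | contradiction

@[simp] theorem store_agree : R.store e 16 = R.agree := rfl
@[simp] theorem update_agree : Function.update (R.store e) 16 v = { R with agree := v }.store e :=
  update_store rfl fun r hr => by unfold store; split <;> first | rfl | contradiction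

@[simp] theorem store_flagA : R.store e 17 = R.flagA := rfl
@[simp] theorem update_flagA : Function.update (R.store e) 17 v = { R with flagA := v }.store e :=
  update_store rfl fun r hr => by unfold store; split <;> first | rfl | contradiction

@[simp] theorem store_flagB : R.store e 18 = R.flagB := rfl
@[simp] theorem update_flagB : Function.update (R.store e) 18 v = { R with flagB := v }.store e :=
  update_store rfl fun r hr => by unfold store; split <;> first | rfl | contradiction

@[simp] theorem store_flagC : R.store e 19 = R.flagC := rfl
@[simp] theorem update_flagC : Function.update (R.store e) 19 v = { R with flagC := v }.store e :=
  update_store rfl fun r hr => by unfold store; split <;> first | rfl | contradiction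

@[simp] theorem store_flagD : R.store e 20 = R.flagD := rfl
@[simp] theorem update_flagD : Function.update (R.store e) 20 v = { R with flagD := v }.store e :=
  update_store rfl fun r hr => by unfold store; split <;> first | rfl | contradiction

@[simp] theorem store_aux : R.store e 21 = R.aux := rfl
@[simp] theorem update_aux : Function.update (R.store e) 21 v = { R with aux := v }.store e :=
  update_store rfl fun r hr => by unfold store; split <;> first | rfl | contradiction

theorem store_sub (r : ℕ) : R.store e (r + 22) = e r := rfl

@[simp] theorem store_sub_zero : R.store e 22 = e 0 := rfl

theorem update_sub (r : ℕ) :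
    Function.update (R.store e) (r + 22) v = R.store (Function.update e r v) := by
  funext k
  obtain hk | hk := lt_or_ge k 22
  · rw [Function.update_of_ne (by omega)]
    interval_cases k <;> rfl
  · obtain ⟨k, rfl⟩ := Nat.exists_eq_add_of_le' hk
    by_cases h : k = r <;> simp [store_sub, h]

@[simp] theorem update_sub_zero :
    Function.update (R.store e) 22 v = R.store (Function.update e 0 v) := update_sub R e v 0

end Regs

/-- The program with all registers shifted by `22`. -/
def Prog.shift : Prog → Prog
  | .skip => .skip
  | .push r b => .push (r + 22) b
  | .pop r => .pop (r + 22)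
  | .seq p q => .seq p.shift q.shift
  | .branch r p₀ p₁ p₂ => .branch (r + 22) p₀.shift p₁.shift p₂.shift
  | .loop r p => .loop (r + 22) p.shift

/-- The program that enumerates the adversaries may use any registers. Shifted, it runs beside the
working registers without touching them and with the same step count. -/
theorem Exec.shift (R : Regs) {p : Prog} {e e' : Store} {t : ℕ} (h : Exec p e t e') :
    Exec p.shift (R.store e) t (R.store e') := by
  induction h with
  | skip s => exact .skip _
  | push r b s => simpa [Prog.shift, Regs.update_sub, Regs.store_sub] using Exec.push (r + 22) b (R.store s)
  | pop r s => simpa [Prog.shift, Regs.update_sub, Regs.store_sub] using Exec.pop (r + 22) (R.store s)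
  | seq _ _ ih₁ ih₂ => exact .seq ih₁ ih₂
  | branchEmpty h _ ih => exact .branchEmpty h ih
  | branchFalse h _ ih => exact .branchFalse h ih
  | branchTrue h _ ih => exact .branchTrue h ih
  | loopDone h => exact .loopDone h
  | loopStep h _ _ ih₁ ih₂ => exact .loopStep h ih₁ ih₂

/-! ### Basic programs -/

/-- Empties register `r`. -/
def clear (r : ℕ) : Prog := .loop r (.pop r)

/-- Moves the contents of `r` to `d`, in reverse order. -/
def move (r d : ℕ) : Prog :=
  .loop r (.branch r .skip (.push d false ;; .pop r) (.push d true ;; .pop r))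

/-- Moves the contents of `r` to `d` and to `d'`, in reverse order. -/
def moveTwo (r d d' : ℕ) : Prog :=
  .loop r (.branch r .skip (.push d false ;; .push d' false ;; .pop r)
    (.push d true ;; .push d' true ;; .pop r))

/-- Copies the contents of `r` to `d`, with the help of the empty register `2`. -/
def copy (r d : ℕ) : Prog := move r 2 ;; moveTwo 2 d r

/-- Repeats `body` for every item of the code of a list on register `r`, with the help of the
empty register `f`. -/
def forList (f r : ℕ) (body : Prog) : Prog :=
  .push f true ;;
    .loop f (.branch r .skip (.pop r ;; .pop f) (.pop r ;; body))

theorem runs_clear (r : ℕ) (s : Store) :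
    Runs (clear r) s (2 * (s r).length + 1) (Function.update s r []) := by
  generalize hl : s r = l
  induction l generalizing s with
  | nil => exact wp_loop_of_eq_nil hl ⟨by simp, by simp [← hl]⟩
  | cons b l ih =>
    refine wp_loop_of_ne_nil (by simp [hl]) (wp_pop.2 ?_)
    refine (ih (Function.update s r (s r).tail) (by simp [hl])).wp fun t ht => ⟨?_, by simp⟩
    simp only [List.length_cons]; omega

theorem runs_move {r d : ℕ} (h : r ≠ d) (s : Store) :
    Runs (move r d) s (4 * (s r).length + 1)
      (Function.update (Function.update s d ((s r).reverse ++ s d)) r []) := by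
  generalize hl : s r = l
  induction l generalizing s with
  | nil =>
    exact wp_loop_of_eq_nil hl ⟨by simp, by symm; simp [hl]⟩
  | cons b l ih =>
    refine wp_loop_of_ne_nil (by simp [hl]) (wp_branch.2 ?_)
    rw [hl]
    cases b
    all_goals
      refine wp_seq.2 (wp_push.2 (wp_pop.2 ?_))
      refine (ih _ (by simp [h, hl])).wp fun t ht => ⟨?_, ?_⟩
      · simp only [List.length_cons]; omega
      · funext k
        by_cases hr : k = r <;> by_cases hd : k = d <;>
          simp [hr, hd, h, h.symm]

theorem runs_moveTwo {r d d' : ℕ} (h : r ≠ d) (h' : r ≠ d') (hd : d ≠ d') (s : Store) :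
    Runs (moveTwo r d d') s (5 * (s r).length + 1)
      (Function.update (Function.update (Function.update s d ((s r).reverse ++ s d))
        d' ((s r).reverse ++ s d')) r []) := by
  generalize hl : s r = l
  induction l generalizing s with
  | nil =>
    exact wp_loop_of_eq_nil hl ⟨by simp, by symm; simp [hl]⟩
  | cons b l ih =>
    refine wp_loop_of_ne_nil (by simp [hl]) (wp_branch.2 ?_)
    rw [hl]
    cases b
    all_goals
      refine wp_seq.2 (wp_push.2 (wp_seq.2 (wp_push.2 (wp_pop.2 ?_))))
      refine (ih _ (by simp [h, h', hl])).wp fun t ht => ⟨?_, ?_⟩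
      · simp only [List.length_cons]; omega
      · funext k
        by_cases hr : k = r <;> by_cases hk : k = d <;> by_cases hk' : k = d' <;>
          simp_all [Function.update_apply, eq_comm]

/-- Each of the two moves reverses the word, so the order is restored. The costs are 4 and 5 steps
per bit, plus one final test for each loop. -/
theorem runs_copy {r d : ℕ} (h : r ≠ d) (h2 : r ≠ 2) (hd : d ≠ 2) {s : Store} (hs : s 2 = []) :
    Runs (copy r d) s (9 * (s r).length + 2) (Function.update s d (s r ++ s d)) := by
  refine wp_seq.2 ((runs_move h2 s).wp fun t ht => ?_)
  refine (runs_moveTwo hd.symm h2.symm h.symm _).wp fun t' ht' => ⟨?_, ?_⟩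
  · simp [h2.symm, hs] at ht'
    omega
  · funext k
    by_cases hr : k = r
    · simp [hr, h, h2, h2.symm, hs]
    · by_cases hk : k = d
      · simp [hk, h.symm, hd, hs, h2.symm]
      · by_cases hk' : k = 2
        · simp [hk', hd.symm, h2.symm, hs]
        · simp [hr, hk, hk']

/-- A loop over the code of a list: `σ ys xs` is the store when the items `ys` have been
processed and the items `xs` have not. -/
theorem runs_forList_length {α : Type} {enc : α → List Bool} {f r : ℕ} (hfr : f ≠ r) {body : Prog}
    {l : List α} {w : List Bool} {c : ℕ} (σ : List α → List α → Store)
    (hf : ∀ ys xs, l = ys ++ xs → σ ys xs f = [])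
    (hr : ∀ ys xs, l = ys ++ xs → σ ys xs r = encList enc xs ++ w)
    (hbody : ∀ ys x xs, l = ys ++ x :: xs →
      Runs body (Function.update (Function.update (σ ys (x :: xs)) f [true]) r
        (enc x ++ (encList enc xs ++ w))) c (Function.update (σ (ys ++ [x]) xs) f [true])) :
    Runs (forList f r body) (σ [] l) ((c + 3) * l.length + 6)
      (Function.update (σ l []) r w) := by
  -- Register `f` holds the flag `[true]` while the loop runs, and the end marker of the list makes
  -- the program pop it. An item costs the loop test, the branch, one pop and the body, hence `c +
  -- 3`. The end costs 5 steps, and the initial push makes 6.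
  have key : ∀ xs ys, l = ys ++ xs →
      Runs (.loop f (.branch r .skip (.pop r ;; .pop f) (.pop r ;; body)))
        (Function.update (σ ys xs) f [true]) ((c + 3) * xs.length + 5)
        (Function.update (σ l []) r w) := by
    intro xs
    induction xs with
    | nil =>
      intro ys h
      refine wp_loop_of_ne_nil (by simp) (wp_branch.2 ?_)
      rw [Function.update_of_ne hfr.symm, hr _ _ h]
      refine wp_seq.2 (wp_pop.2 (wp_pop.2 (wp_loop_of_eq_nil (by simp [hfr]) ⟨by simp, ?_⟩)))
      obtain rfl : l = ys := by simpa using h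
      funext k
      by_cases hk : k = r <;> by_cases hk' : k = f
      · exact absurd (hk'.symm.trans hk) hfr
      · simp [hk, hfr, hfr.symm, hr _ _ h, encList]
      · simp [hk', hfr, hf _ _ h]
      · simp [hk, hk']
    | cons x xs ih =>
      intro ys h
      refine wp_loop_of_ne_nil (by simp) (wp_branch.2 ?_)
      rw [Function.update_of_ne hfr.symm, hr _ _ h]
      refine wp_seq.2 (wp_pop.2 ?_)
      have hb := hbody ys x xs h
      rw [Function.update_of_ne hfr.symm, hr _ _ h]
      simp only [encList, List.cons_append, List.tail_cons, List.append_assoc]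
      refine hb.wp fun t ht => (ih (ys ++ [x]) (by simp [h])).wp fun t' ht' => ⟨?_, rfl⟩
      simp only [List.length_cons, Nat.mul_succ]
      omega
  refine wp_seq.2 (wp_push.2 ?_)
  rw [hf [] l rfl]
  exact (key l [] rfl).wp fun t ht => ⟨by omega, rfl⟩

/-- The form for applications: the stores at both ends enter through equations left to `simp`, and
the number of items through a bound `M`, so that the costs of nested loops are polynomials in one
variable. -/
theorem runs_forList {α : Type} {enc : α → List Bool} {f r : ℕ} (hfr : f ≠ r) {body : Prog}
    {l : List α} {w : List Bool} {c M : ℕ} {s s' : Store} (σ : List α → List α → Store)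
    (hl : l.length ≤ M) (hs : s = σ [] l) (hs' : s' = Function.update (σ l []) r w)
    (hf : ∀ ys xs, l = ys ++ xs → σ ys xs f = [])
    (hr : ∀ ys xs, l = ys ++ xs → σ ys xs r = encList enc xs ++ w)
    (hbody : ∀ ys x xs, l = ys ++ x :: xs →
      Runs body (Function.update (Function.update (σ ys (x :: xs)) f [true]) r
        (enc x ++ (encList enc xs ++ w))) c (Function.update (σ (ys ++ [x]) xs) f [true])) :
    Runs (forList f r body) s ((c + 3) * M + 6) s' := by
  subst hs hs'
  exact (runs_forList_length hfr σ hf hr hbody).mono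
    (Nat.add_le_add_right (Nat.mul_le_mul_left _ hl) _)

/-! ### Reading and writing numbers -/

/-- A unary number is a list of items with empty code, so numbers can be read by the same loop as
lists. -/
theorem encNat_eq_encList (k : ℕ) :
    encNat k = encList (fun _ : Unit => []) (List.replicate k ()) := by
  induction k with
  | zero => rfl
  | succ k ih => simpa [encNat, List.replicate_succ, encList] using ih

/-- Reads a unary number from `r`, and pushes it on `d` without its end marker. -/
def readNat (f r d : ℕ) : Prog := forList f r (.push d true)

theorem runs_readNat {f r d : ℕ} (hfr : f ≠ r) (hfd : f ≠ d) (hrd : r ≠ d) {s : Store} {k : ℕ}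
    {w : List Bool} (hf : s f = []) (hr : s r = encNat k ++ w) :
    Runs (readNat f r d) s (4 * k + 6)
      (Function.update (Function.update s d (List.replicate k true ++ s d)) r w) := by
  have h := runs_forList_length (enc := fun _ : Unit => []) (body := .push d true)
    (l := List.replicate k ()) (w := w) (c := 1) hfr
    (fun ys xs => Function.update (Function.update s d (List.replicate ys.length true ++ s d)) r
      (encList (fun _ : Unit => []) xs ++ w))
    (by intro ys xs _; simp [hfr, hfd, hf]) (by intro ys xs _; simp) ?_
  · convert h using 1
    · rfl
    · rw [← encNat_eq_encList, ← hr]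
      simp
    · simp
    · simp
  · intro ys x xs _
    refine wp_push.2 ⟨le_rfl, ?_⟩
    funext j
    by_cases hj : j = f <;> by_cases hj' : j = d <;> by_cases hj'' : j = r <;>
      simp_all [List.replicate_succ, Function.update_apply]

def varCode (k : ℕ) : List Bool := false :: encNat k

/-- Writes the variable whose number is on register `r`. -/
def emitVar (r : ℕ) : Prog := .push 1 false ;; copy r 1 ;; .push 1 false

/-- Register `1` accumulates the output with its last bit on top. This is why all output appears
reversed until `finish` turns it around. -/
theorem runs_emitVar {r : ℕ} (h1 : r ≠ 1) (h2 : r ≠ 2) {s : Store} {k : ℕ} (hs : s 2 = [])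
    (hr : s r = List.replicate k true) :
    Runs (emitVar r) s (9 * k + 4) (Function.update s 1 ((varCode k).reverse ++ s 1)) := by
  simp only [Runs, emitVar, wp_seq, wp_push]
  refine (runs_copy h1 h2 (by decide) (by simp [hs])).wp fun t ht => ⟨?_, ?_⟩
  · simp [h1, hr] at ht
    omega
  · simp [varCode, encNat, h1, hr]

/-- Copies the code of a list of numbers from register `7` to register `2`, reversed. -/
def copyNats : Prog :=
  forList 19 7 (.push 2 true ;; readNat 20 7 2 ;; .push 2 false) ;; .push 2 false

/-- Without the end marker, codes of partial lists concatenate. This gives the invariants of the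
writing loops. -/
theorem encList_eq_flatMap {α : Type} (enc : α → List Bool) (l : List α) :
    encList enc l = (l.flatMap fun x => true :: enc x) ++ [false] := by
  induction l with
  | nil => rfl
  | cons x l ih => simp [encList, ih]

section

variable {R : Regs} {e : Store} {w : List Bool} {M : ℕ}

theorem runs_copyNats {α : Type} {k : α → ℕ} {l : List α} (hl : l.length ≤ M)
    (hk : ∀ x ∈ l, k x ≤ M) (hC : R.flagC = []) (hD : R.flagD = [])
    (hr : R.outer = encList (fun x => encNat (k x)) l ++ w) :
    Runs copyNats (R.store e) ((4 * M + 8 + 3) * M + 7)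
      ({ R with
          outer := w
          tmp := (encList (fun x => encNat (k x)) l).reverse ++ R.tmp }.store e) := by
  have h := runs_forList (enc := fun x => encNat (k x)) (l := l) (w := w) (c := 4 * M + 8)
    (f := 19) (r := 7) (s := R.store e) (M := M)
    (s' := { R with
          outer := w
          tmp := (l.flatMap fun x => true :: encNat (k x)).reverse ++ R.tmp }.store e)
    (body := .push 2 true ;; readNat 20 7 2 ;; .push 2 false) (by decide)
    (fun ys xs => { R with
          outer := encList (fun x => encNat (k x)) xs ++ w
          tmp := (ys.flatMap fun x => true :: encNat (k x)).reverse ++ R.tmp }.store e)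
    hl (by cases R; simp_all) (by simp)
    (by intro ys xs _; simp [hC]) (by intro ys xs _; simp) ?_
  · simp only [Runs, copyNats, wp_seq]
    refine h.wp fun t ht => ?_
    simp only [wp_push]
    exact ⟨by omega, by simp [encList_eq_flatMap]⟩
  · intro ys x xs hx
    have := hk x (by simp [hx])
    simp only [Runs, wp_seq, wp_push]
    refine (runs_readNat (k := k x) (w := encList (fun x => encNat (k x)) xs ++ w)
      (by decide) (by decide) (by decide) (by simp [hD]) (by simp)).wp fun t ht => ⟨?_, ?_⟩
    · omega
    · simp [encNat]


/-! ### Comparing tuples -/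

/-- Empties the registers `14` and `15`, which hold unary numbers, and also register `16` if
these numbers are different. -/
def compareNats : Prog :=
  .loop 14 (.pop 14 ;; .branch 15 (clear 16) (.pop 15) (.pop 15)) ;;
    .branch 15 .skip (clear 16 ;; clear 15) (clear 16 ;; clear 15)

theorem runs_compareNats {a b : ℕ} (ha : R.cntA = List.replicate a true)
    (hb : R.cntB = List.replicate b true) (hE : R.agree.length ≤ 1) :
    Runs compareNats (R.store e) (7 * a + 2 * b + 12)
      ({ R with cntA := [], cntB := [], agree := if a = b then R.agree else [] }.store e) := by
  -- The first loop clears the flag exactly if `b` runs out before `a`, and it leaves the truncated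
  -- difference `b - a`. A nonempty rest then detects `a < b`.
  have key : Runs (.loop 14 (.pop 14 ;; .branch 15 (clear 16) (.pop 15) (.pop 15))) (R.store e)
      (7 * a + 1) ({ R with
        cntA := []
        cntB := List.replicate (b - a) true
        agree := if a ≤ b then R.agree else [] }.store e) := by
    induction a generalizing R b with
    | zero => exact wp_loop_of_eq_nil (by simpa using ha) ⟨by simp, by cases R; simp_all⟩
    | succ a ih =>
      refine wp_loop_of_ne_nil (by simp [ha]) ?_
      cases b with
      | zero =>
        simp only [wp_seq, wp_pop, wp_branch, Regs.store_cntA, Regs.update_cntA,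
          Regs.store_cntB, hb, List.replicate_zero]
        refine (runs_clear _ _).wp fun t ht => ?_
        simp only [Regs.store_agree, Regs.update_agree] at ht ⊢
        refine (ih (b := 0) (by simp [ha, List.replicate_succ]) (by simp)
          (by simp)).wp fun t' ht' => ⟨by omega, by simp⟩
      | succ b =>
        simp only [wp_seq, wp_pop, wp_branch, Regs.store_cntA, Regs.update_cntA,
          Regs.store_cntB, Regs.update_cntB, hb, List.replicate_succ]
        refine (ih (b := b) (by simp [ha, List.replicate_succ]) (by simp)
          (by simpa using hE)).wp fun t' ht' => ⟨by omega, by simp⟩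
  simp only [Runs, compareNats, wp_seq]
  refine key.wp fun t ht => ?_
  rw [wp_branch, Regs.store_cntB]
  obtain h | h := Nat.eq_zero_or_pos (b - a)
  · simp only [h, List.replicate_zero, wp_skip]
    refine ⟨by omega, ?_⟩
    by_cases hab : a = b
    · simp [hab]
    · simp [hab, show ¬ a ≤ b by omega]
  · obtain ⟨k, hk⟩ := Nat.exists_eq_add_of_lt h
    simp only [hk, List.replicate_succ, wp_seq]
    refine (runs_clear _ _).wp fun t ht => (runs_clear _ _).wp fun t' ht' => ?_
    simp [show a ≤ b by omega, show a ≠ b by omega] at ht ht' ⊢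
    omega

variable {m : ℕ}

/-- Translates the loop invariants, stated for the list of processed items, into statements about
the current index. -/
theorem finRange_split {ys xs : List (Fin m)} {i : Fin m} (h : List.finRange m = ys ++ i :: xs) :
    ys.length = i ∧ ∀ j, j ∈ ys ↔ j < i := by
  have hi : ys.length = i := by
    have h1 : ys.length < (List.finRange m).length := by simp [h]
    have h2 : (List.finRange m)[ys.length] = i := by simp [h]
    simpa [Fin.ext_iff] using h2
  have hy : ys = (List.finRange m).take i := by simp [h, ← hi]
  refine ⟨hi, fun j => ?_⟩
  rw [hy, List.mem_take_iff_getElem]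
  constructor
  · rintro ⟨k, hk, rfl⟩
    simp only [List.length_finRange, lt_min_iff] at hk
    simpa [Fin.lt_def] using hk.1
  · intro hj
    exact ⟨j, lt_min hj (by simp), by simp⟩

/-- The code of a tuple of numbers. -/
def tupleCode (t : Fin m → ℕ) : List Bool := encList (fun i => encNat (t i)) (List.finRange m)

/-- The equality of the variables number `o + i` and `o' + i`, if the tuples `t` and `t'` agree
up to the coordinate `i`. -/
def agreeItem (o o' : ℕ) (t t' : Fin m → ℕ) (i : Fin m) : List Bool :=
  if ∀ j ≤ i, t j = t' j then true :: false :: (varCode (o + i) ++ varCode (o' + i)) else []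

/-- Register `16` is nonempty as long as the two tuples have agreed. Only the tuple on register `10`
drives the loop, so the item marker of the other one on register `8` is popped by hand. Registers
`11` and `12` hold the numbers of the two current variables. -/
def agreeStep : Prog :=
  .pop 8 ;; readNat 20 10 14 ;; readNat 20 8 15 ;; compareNats ;;
    .branch 16 .skip .skip (.push 1 true ;; .push 1 false ;; emitVar 11 ;; emitVar 12) ;;
    .push 11 true ;; .push 12 true

/-- One pass suffices because agreement up to `i` is monotone: once cleared, the flag stays cleared.
The end marker of the second tuple is left on `inner` for the caller. -/
theorem runs_agreeLoop {o o' : ℕ} {t t' : Fin m → ℕ} {w w' : List Bool} (ho : o + m ≤ M)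
    (ho' : o' + m ≤ M) (ht : ∀ i, t i ≤ M) (ht' : ∀ i, t' i ≤ M) (hC : R.flagC = [])
    (hD : R.flagD = []) (hA : R.cntA = []) (hB : R.cntB = []) (htmp : R.tmp = [])
    (hE : R.agree = [true]) (hs : R.scan = tupleCode t ++ w) (hin : R.inner = tupleCode t' ++ w')
    (hi : R.idx = List.replicate o true) (hi' : R.idx2 = List.replicate o' true) :
    Runs (forList 19 10 agreeStep) (R.store e) ((35 * M + 57 + 3) * M + 6)
      ({ R with
          scan := w
          inner := false :: w'
          idx := List.replicate (o + m) true
          idx2 := List.replicate (o' + m) true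
          agree := if ∀ i, t i = t' i then [true] else []
          out := ((List.finRange m).flatMap (agreeItem o o' t t')).reverse ++ R.out }.store e) := by
  refine runs_forList (enc := fun i => encNat (t i)) (l := List.finRange m) (w := w)
    (c := 35 * M + 57) (by decide)
    (fun ys xs => { R with
          scan := encList (fun i => encNat (t i)) xs ++ w
          inner := encList (fun i => encNat (t' i)) xs ++ w'
          idx := List.replicate (o + ys.length) true
          idx2 := List.replicate (o' + ys.length) true
          agree := if ∀ i ∈ ys, t i = t' i then [true] else []
          out := (ys.flatMap (agreeItem o o' t t')).reverse ++ R.out }.store e)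
    (by simp; omega) (by cases R; simp_all [tupleCode]) (by simp [encList])
    (by intro ys xs _; simp [hC]) (by intro ys xs _; simp) ?_
  intro ys i xs hx
  obtain ⟨hy, hmem⟩ := finRange_split hx
  have h1 := ht i
  have h2 := ht' i
  have h3 := i.2
  have hag : (∀ j ≤ i, t j = t' j) ↔ t i = t' i ∧ ∀ j ∈ ys, t j = t' j := by
    constructor
    · exact fun h => ⟨h i le_rfl, fun j hj => h j ((hmem j).1 hj).le⟩
    · rintro ⟨h, h'⟩ j hj
      obtain rfl | hj := hj.eq_or_lt
      exacts [h, h' j ((hmem j).2 hj)]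
  simp only [Runs, agreeStep, wp_seq, wp_pop]
  refine (runs_readNat (k := t i) (w := encList (fun i => encNat (t i)) xs ++ w)
    (by decide) (by decide) (by decide) (by simp [hD]) (by simp)).wp fun s₁ hs₁ => ?_
  refine (runs_readNat (k := t' i) (w := encList (fun i => encNat (t' i)) xs ++ w')
    (by decide) (by decide) (by decide) (by simp [hD]) (by simp [encList])).wp fun s₂ hs₂ => ?_
  simp only [Regs.update_scan, Regs.store_inner, Regs.update_inner,
    Regs.store_cntA, Regs.update_cntA, Regs.store_cntB, Regs.update_cntB, Regs.update_flagC,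
    hA, hB, List.append_nil]
  refine (runs_compareNats rfl rfl (by split_ifs <;> simp)).wp fun s₃ hs₃ => ?_
  rw [wp_branch, Regs.store_agree]
  by_cases hcase : ∀ j ≤ i, t j = t' j
  · have hcase' := hag.1 hcase
    simp only [if_pos hcase'.1, if_pos hcase'.2, wp_seq, wp_push]
    refine (runs_emitVar (k := o + i) (by decide) (by decide) (by simp [htmp])
      (by simp [hy])).wp fun s₄ hs₄ => ?_
    refine (runs_emitVar (k := o' + i) (by decide) (by decide) (by simp [htmp])
      (by simp [hy])).wp fun s₅ hs₅ => ⟨?_, ?_⟩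
    · omega
    · simp [agreeItem, if_pos hcase, hcase', or_imp, forall_and, hy, ← Nat.add_assoc,
        List.replicate_succ]
      rw [if_pos hcase'.2]
  · have : (if t i = t' i then if ∀ j ∈ ys, t j = t' j then [true] else [] else []) = [] := by
      split_ifs with h h' <;> first | rfl | exact absurd (hag.2 ⟨h, h'⟩) hcase
    simp only [this, wp_skip, wp_push]
    refine ⟨by omega, ?_⟩
    have h4 : ¬ ∀ j ∈ ys ++ [i], t j = t' j := fun h =>
      hcase (hag.2 ⟨h i (by simp), fun j hj => h j (by simp [hj])⟩)
    simp only [if_neg h4]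
    simp [agreeItem, if_neg hcase, hy, ← Nat.add_assoc, List.replicate_succ]

end

section

variable {R : Regs} {e : Store} {w : List Bool} {M m W : ℕ}

/-- Writes the equalities between the variables of the tuple on register `9` and those of the
first tuple on register `8`. -/
def agreeTuples : Prog :=
  copy 9 10 ;; copy 13 11 ;; .push 16 true ;; forList 19 10 agreeStep ;; .pop 8 ;; clear 11 ;;
    clear 16

theorem runs_agreeTuples {o o' : ℕ} {t t' : Fin m → ℕ} {w' : List Bool} (ho : o + m ≤ M)
    (ho' : o' + m ≤ M) (ht : ∀ i, t i ≤ M) (ht' : ∀ i, t' i ≤ M) (hM : (tupleCode t).length ≤ M)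
    (hC : R.flagC = []) (hD : R.flagD = []) (hA : R.cntA = []) (hB : R.cntB = [])
    (htmp : R.tmp = []) (hE : R.agree = []) (hcur : R.cur = tupleCode t) (hs : R.scan = [])
    (hin : R.inner = tupleCode t' ++ w') (hi : R.idx = []) (ho₁ : R.off = List.replicate o true)
    (hi' : R.idx2 = List.replicate o' true) :
    Runs agreeTuples (R.store e) ((35 * M + 57 + 3) * M + 6 + 20 * M + 20)
      ({ R with
          inner := w'
          idx2 := List.replicate (o' + m) true
          out := ((List.finRange m).flatMap (agreeItem o o' t t')).reverse ++ R.out }.store e) := by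
  simp only [Runs, agreeTuples, wp_seq]
  refine (runs_copy (by decide) (by decide) (by decide) (by simpa using htmp)).wp
    fun s₁ hs₁ => ?_
  simp only [Regs.store_cur, Regs.store_scan, Regs.update_scan, hs, List.append_nil] at hs₁ ⊢
  refine (runs_copy (by decide) (by decide) (by decide) (by simpa using htmp)).wp
    fun s₂ hs₂ => ?_
  simp only [Regs.store_off, Regs.store_idx, Regs.update_idx, hi, ho₁, List.append_nil,
    List.length_replicate, wp_push, Regs.update_agree, Regs.store_agree, hE] at hs₂ ⊢
  refine Runs.wp (runs_agreeLoop (w := []) ho ho' ht ht' hC hD hA hB htmp rfl (by simp [hcur])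
    hin rfl hi') fun s₃ hs₃ => ?_
  simp only [wp_pop, Regs.store_inner, Regs.update_inner, List.tail_cons]
  refine (runs_clear _ _).wp fun s₄ hs₄ => (runs_clear _ _).wp fun s₅ hs₅ => ⟨?_, ?_⟩
  · have : (if ∀ i, t i = t' i then [true] else []).length ≤ 1 := by split_ifs <;> simp
    simp only [Regs.store_idx, Regs.store_agree, Regs.update_idx, List.length_replicate] at hs₄ hs₅
    rw [hcur] at hs₁
    omega
  · cases R
    simp_all

/-- Writes the equalities between the variables of the tuple on register `9` and those of all
tuples. -/
def agreeAll : Prog := copy 6 8 ;; forList 18 8 agreeTuples ;; clear 12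

/-- The code of a list of tuples of numbers. -/
def tuplesCode (T : Fin W → Fin m → ℕ) : List Bool :=
  encList (fun g => tupleCode (T g)) (List.finRange W)

/-- All `g'` are included, also `g' = g`; the resulting trivial equalities are harmless and keep the
loop uniform. -/
def agreeCode (T : Fin W → Fin m → ℕ) (g : Fin W) : List Bool :=
  (List.finRange W).flatMap fun g' : Fin W =>
    (List.finRange m).flatMap (agreeItem (m * g) (m * g') (T g) (T g'))

theorem mul_add_le_of_fin (g : Fin W) (h : m * W ≤ M) : m * g + m ≤ M :=
  (Nat.mul_le_mul_left m (Nat.succ_le_of_lt g.2)).trans h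

/-- Register `idx2` is not reset between tuples: each pass adds `m`, so it holds `m * g'` when tuple
`g'` is reached. -/
theorem runs_agreeAll {T : Fin W → Fin m → ℕ} {g : Fin W} (hW : W ≤ M) (hmW : m * W ≤ M)
    (hT : ∀ g i, T g i ≤ M) (hM : ∀ g, (tupleCode (T g)).length ≤ M)
    (hM' : (tuplesCode T).length ≤ M)
    (hBf : R.flagB = []) (hC : R.flagC = []) (hD : R.flagD = []) (hA : R.cntA = [])
    (hB : R.cntB = []) (htmp : R.tmp = []) (hE : R.agree = []) (hcur : R.cur = tupleCode (T g))
    (hs : R.scan = []) (hin : R.inner = []) (hi : R.idx = [])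
    (ho : R.off = List.replicate (m * g) true) (hi' : R.idx2 = [])
    (hTs : R.tuples = tuplesCode T) :
    Runs agreeAll (R.store e)
      (((35 * M + 57 + 3) * M + 6 + 20 * M + 20 + 3) * M + 6 + 11 * M + 3)
      ({ R with out := (agreeCode T g).reverse ++ R.out }.store e) := by
  simp only [Runs, agreeAll, wp_seq]
  refine (runs_copy (by decide) (by decide) (by decide) (by simpa using htmp)).wp
    fun s₁ hs₁ => ?_
  simp only [Regs.store_tuples, Regs.store_inner, Regs.update_inner, hin, List.append_nil]
    at hs₁ ⊢
  have h := runs_forList (enc := fun g' => tupleCode (T g')) (l := List.finRange W) (w := [])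
    (c := (35 * M + 57 + 3) * M + 6 + 20 * M + 20) (f := 18) (r := 8) (body := agreeTuples)
    (M := M)
    (s := { R with inner := R.tuples }.store e)
    (s' := { R with
      inner := []
      idx2 := List.replicate (m * W) true
      out := (agreeCode T g).reverse ++ R.out }.store e)
    (by decide)
    (fun ys xs => { R with
          inner := encList (fun g' => tupleCode (T g')) xs
          idx2 := List.replicate (m * ys.length) true
          out := (ys.flatMap fun g' : Fin W => (List.finRange m).flatMap
            (agreeItem (m * g) (m * g') (T g) (T g'))).reverse ++ R.out }.store e)
    (by simpa using hW) (by cases R; simp_all [tuplesCode]) (by simp [agreeCode])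
    (by intro ys xs _; simp [hBf]) (by intro ys xs _; simp) ?_
  · refine Runs.wp h fun s₂ hs₂ => Runs.wp (runs_clear _ _) fun s₃ hs₃ => ⟨?_, ?_⟩
    · simp only [Regs.store_idx2, List.length_replicate] at hs₃
      rw [hTs] at hs₁
      omega
    · cases R
      simp_all
  · intro ys g' xs hx
    obtain ⟨hy, -⟩ := finRange_split hx
    simp only [Regs.update_flagB, Regs.update_inner]
    refine Runs.wp (runs_agreeTuples (t := T g) (t' := T g') (o := m * g) (o' := m * g')
      (w' := encList (fun g' => tupleCode (T g')) xs) (mul_add_le_of_fin g hmW)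
      (mul_add_le_of_fin g' hmW) (hT g) (hT g') (hM g) hC hD hA hB htmp hE hcur hs (by simp)
      hi ho (by simp [hy])) fun s hs => ⟨hs, ?_⟩
    simp [hy, Nat.mul_succ]

/-! ### The values of universal variables -/

/-- For an existential variable the entry of the tuple is still consumed, into a scratch register,
so that tuple and quantifiers stay in step. For a universal one the entry is copied to the output as
the code of a constant. -/
def univStep : Prog :=
  .branch 5 .skip (.pop 5 ;; readNat 19 10 14 ;; clear 14)
    (.pop 5 ;; .push 1 true ;; .push 1 false ;; emitVar 11 ;; .push 1 true ;;
      readNat 19 10 1 ;; .push 1 false) ;;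
  .push 11 true

/-- Writes that the universal variables take the values given by the tuple on register `9`. -/
def univAll : Prog :=
  copy 9 10 ;; copy 3 5 ;; copy 13 11 ;; forList 18 10 univStep ;; clear 11

def univItem (o : ℕ) (q : Fin m → Bool) (t : Fin m → ℕ) (i : Fin m) : List Bool :=
  if q i then true :: false :: (varCode (o + i) ++ true :: encNat (t i)) else []

theorem runs_univStep {o : ℕ} {q : Bool} {k : ℕ} {w w' : List Bool}
    (hC : R.flagC = []) (hA : R.cntA = []) (htmp : R.tmp = []) (hs : R.scan = encNat k ++ w)
    (hq : R.qscan = q :: w') (hi : R.idx = List.replicate o true) :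
    Runs univStep (R.store e) (9 * o + 6 * k + 20)
      ({ R with
          scan := w
          qscan := w'
          idx := List.replicate (o + 1) true
          out := (if q then true :: false :: (varCode o ++ true :: encNat k) else []).reverse ++
            R.out }.store e) := by
  simp only [Runs, univStep, wp_seq, wp_branch, Regs.store_qscan, hq]
  cases q
  · simp only [wp_pop, Regs.store_qscan, Regs.update_qscan, hq, List.tail_cons]
    refine (runs_readNat (k := k) (w := w) (by decide) (by decide) (by decide) (by simp [hC])
      (by simp [hs])).wp fun s₁ hs₁ => (runs_clear _ _).wp fun s₂ hs₂ => ?_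
    simp [hA] at hs₂
    rw [wp_push]
    refine ⟨by omega, ?_⟩
    cases R
    simp_all [List.replicate_succ]
  · simp only [wp_pop, wp_push, Regs.store_qscan, Regs.update_qscan, hq, List.tail_cons,
      Regs.store_out, Regs.update_out]
    refine (runs_emitVar (k := o) (by decide) (by decide) (by simp [htmp])
        (by simp [hi])).wp fun s₁ hs₁ => ?_
    refine (runs_readNat (k := k) (w := w) (by decide) (by decide) (by decide) (by simp [hC])
      (by simp [hs])).wp fun s₂ hs₂ => ⟨by omega, ?_⟩
    cases R
    simp_all [List.replicate_succ, encNat]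

theorem runs_univAll {q : Fin m → Bool} {t : Fin m → ℕ} {o : ℕ} (hm : m ≤ M) (hom : o + m ≤ M)
    (ht : ∀ i, t i ≤ M) (hM : (tupleCode t).length ≤ M)
    (hBf : R.flagB = []) (hC : R.flagC = []) (hA : R.cntA = []) (htmp : R.tmp = [])
    (hcur : R.cur = tupleCode t) (hs : R.scan = []) (hqs : R.qscan = []) (hi : R.idx = [])
    (ho : R.off = List.replicate o true) (hq : R.quants = (List.finRange m).map q) :
    Runs univAll (R.store e) ((15 * M + 20 + 3) * M + 6 + 30 * M + 10)
      ({ R with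
          out := ((List.finRange m).flatMap (univItem o q t)).reverse ++ R.out }.store e) := by
  simp only [Runs, univAll, wp_seq]
  refine (runs_copy (by decide) (by decide) (by decide) (by simpa using htmp)).wp
    fun s₁ hs₁ => ?_
  simp only [Regs.store_cur, Regs.store_scan, Regs.update_scan, hs, List.append_nil] at hs₁ ⊢
  refine (runs_copy (by decide) (by decide) (by decide) (by simpa using htmp)).wp
    fun s₂ hs₂ => ?_
  simp only [Regs.store_quants, Regs.store_qscan, Regs.update_qscan, hqs, List.append_nil]
    at hs₂ ⊢
  refine (runs_copy (by decide) (by decide) (by decide) (by simpa using htmp)).wp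
    fun s₃ hs₃ => ?_
  simp only [Regs.store_off, Regs.store_idx, Regs.update_idx, hi, List.append_nil]
    at hs₃ ⊢
  have h := runs_forList (enc := fun i : Fin m => encNat (t i)) (l := List.finRange m) (w := [])
    (c := 15 * M + 20) (f := 18) (r := 10) (body := univStep)
    (M := M)
    (s := { R with scan := R.cur, qscan := R.quants, idx := R.off }.store e)
    (s' := { R with
      idx := List.replicate (o + m) true
      out := ((List.finRange m).flatMap (univItem o q t)).reverse ++ R.out }.store e)
    (by decide)
    (fun ys xs => { R with
          scan := encList (fun i => encNat (t i)) xs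
          qscan := xs.map q
          idx := List.replicate (o + ys.length) true
          out := (ys.flatMap (univItem o q t)).reverse ++ R.out }.store e)
    (by simpa using hm) (by cases R; simp_all [tupleCode]) (by cases R; simp_all)
    (by intro ys xs _; simp [hBf]) (by intro ys xs _; simp) ?_
  · refine Runs.wp h fun s₂ hs₂ => Runs.wp (runs_clear _ _) fun s₃ hs₃ => ⟨?_, ?_⟩
    · simp only [hq, ho, hcur, Regs.store_idx, List.length_replicate, List.length_map,
        List.length_finRange] at *
      omega
    · cases R
      simp_all
  · intro ys i xs hx
    obtain ⟨hy, -⟩ := finRange_split hx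
    have h1 := ht i
    have h2 := i.2
    simp only [Regs.update_flagB, Regs.update_scan]
    refine Runs.wp (runs_univStep (q := q i) (k := t i) (o := o + i) (w := encList (fun i => encNat (t i)) xs)
      (w' := xs.map q) hC hA htmp (by simp) (by simp) (by simp [hy]))
      fun s hs => ⟨by omega, ?_⟩
    simp [hy, univItem, Nat.add_assoc]

end

/-! ### Copying the quantifier-free part -/

@[simp] theorem length_encNat (k : ℕ) : (encNat k).length = k + 1 := by simp [encNat]

theorem length_le_length_encList {α : Type} (enc : α → List Bool) (l : List α) :
    l.length ≤ (encList enc l).length := by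
  induction l with
  | nil => simp
  | cons x l ih => simp only [encList, List.length_cons, List.length_append]; omega

theorem length_enc_le_length_encList {α : Type} (enc : α → List Bool) {l : List α} {x : α}
    (h : x ∈ l) : (enc x).length < (encList enc l).length := by
  induction l with
  | nil => simp at h
  | cons y l ih =>
    simp only [encList, List.length_cons, List.length_append]
    obtain rfl | h := List.mem_cons.1 h
    · omega
    · have := ih h; omega

section

variable {A : Type} [Fintype A] {L : ConstraintLanguage A} {n : ℕ}

/-- The code of a term with the numbers of the variables increased by `o`. -/
noncomputable def shiftTerm (o : ℕ) : CTerm L n → List Bool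
  | .var i => varCode (o + i)
  | .const a _ => true :: encElem a

/-- The code of an atom with the numbers of the variables increased by `o`. -/
noncomputable def shiftAtom (o : ℕ) : CAtom L n → List Bool
  | .eq s t => false :: (shiftTerm o s ++ shiftTerm o t)
  | .rel R args => true :: (encWord (L.symCode R) ++ encList (shiftTerm o) (List.ofFn args))

/-- Unary addition is concatenation: the offset is written in front of the number of the variable.
Constants are copied unchanged. -/
def termStep : Prog :=
  .branch 21 .skip
    (.pop 21 ;; .push 1 false ;; copy 13 1 ;; readNat 20 21 1 ;; .push 1 false)
    (.pop 21 ;; .push 1 true ;; readNat 20 21 1 ;; .push 1 false)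

/-- The code words of relation symbols are copied bit by bit and never interpreted, so infinitely
many symbols cause no difficulty. -/
def wordStep : Prog :=
  .push 1 true ;; .branch 21 .skip (.pop 21 ;; .push 1 false) (.pop 21 ;; .push 1 true)

def atomStep : Prog :=
  .push 1 true ;;
    .branch 21 .skip (.pop 21 ;; .push 1 false ;; termStep ;; termStep)
      (.pop 21 ;; .push 1 true ;; forList 19 21 wordStep ;; .push 1 false ;;
        forList 19 21 (.push 1 true ;; termStep) ;; .push 1 false)

/-- Writes the quantifier-free part on register `0`, with the numbers of the variables
increased by the number on register `13`. -/
def matrixAll : Prog := copy 0 21 ;; forList 18 21 atomStep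

variable {R : Regs} {e : Store} {w : List Bool} {M o : ℕ}

theorem runs_termStep {τ : CTerm L n} (hD : R.flagD = []) (htmp : R.tmp = [])
    (ho : R.off = List.replicate o true) (hoM : o ≤ M) (hτ : τ.encode.length ≤ M)
    (haux : R.aux = τ.encode ++ w) :
    Runs termStep (R.store e) (13 * M + 20)
      ({ R with aux := w, out := (shiftTerm o τ).reverse ++ R.out }.store e) := by
  simp only [Runs, termStep, wp_branch, Regs.store_aux, haux]
  cases τ with
  | var i =>
    simp only [CTerm.encode, List.cons_append, wp_seq, wp_pop, wp_push, List.tail_cons,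
      List.length_cons, length_encNat, Regs.store_aux, haux, Regs.update_aux, Regs.store_out,
      Regs.update_out] at hτ ⊢
    refine (runs_copy (by decide) (by decide) (by decide) (by simp [htmp])).wp fun s₁ hs₁ => ?_
    refine (runs_readNat (k := i) (w := w) (by decide) (by decide) (by decide) (by simp [hD])
      (by simp)).wp fun s₂ hs₂ => ?_
    simp only [Regs.store_off, ho, List.length_replicate] at hs₁
    refine ⟨by omega, ?_⟩
    simp [shiftTerm, varCode, encNat, ho, ← List.replicate_append_replicate]
  | const a h =>
    simp only [CTerm.encode, encElem, List.cons_append, wp_seq, wp_pop, wp_push, List.tail_cons,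
      List.length_cons, length_encNat, Regs.store_aux, haux, Regs.update_aux, Regs.store_out,
      Regs.update_out] at hτ ⊢
    refine (runs_readNat (k := Fintype.equivFin A a) (w := w) (by decide) (by decide) (by decide)
      (by simp [hD]) (by simp)).wp fun s₂ hs₂ => ?_
    refine ⟨by omega, ?_⟩
    simp [shiftTerm, encElem, encNat]

theorem runs_atomStep {α : CAtom L n} (hC : R.flagC = []) (hD : R.flagD = []) (htmp : R.tmp = [])
    (ho : R.off = List.replicate o true) (hoM : o ≤ M) (hα : α.encode.length ≤ M)
    (haux : R.aux = α.encode ++ w) :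
    Runs atomStep (R.store e) ((13 * M + 24) * M + 7 * M + 26 * M + 60)
      ({ R with aux := w, out := (shiftAtom o α).reverse ++ true :: R.out }.store e) := by
  simp only [Runs, atomStep, wp_seq, wp_push, Regs.store_out, Regs.update_out, wp_branch,
    Regs.store_aux, haux]
  cases α with
  | eq s t =>
    simp only [CAtom.encode, List.cons_append, wp_pop, List.tail_cons,
      List.length_cons, List.length_append, Regs.store_aux, Regs.update_aux, Regs.store_out,
      Regs.update_out] at hα ⊢
    refine Runs.wp (runs_termStep (τ := s) (w := t.encode ++ w) (M := M) hD htmp ho hoM (by omega)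
      (by simp)) fun s₁ hs₁ => ?_
    refine Runs.wp (runs_termStep (τ := t) (w := w) (M := M) hD htmp ho hoM (by omega) rfl)
      fun s₂ hs₂ => ⟨?_, ?_⟩
    · generalize (13 * M + 24) * M = z
      omega
    · simp [shiftAtom]
  | rel S args =>
    have h1 := length_le_length_encList (fun b => [b]) (L.symCode S)
    have h2 := length_le_length_encList CTerm.encode (List.ofFn args)
    have h3 := fun τ => length_enc_le_length_encList CTerm.encode (l := List.ofFn args) (x := τ)
    simp only [CAtom.encode, List.cons_append, wp_pop, List.tail_cons,
      List.length_cons, List.length_append, Regs.store_aux, Regs.update_aux, Regs.store_out,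
      Regs.update_out, encWord] at hα ⊢
    refine Runs.wp (runs_forList (enc := fun b => [b]) (l := L.symCode S) (M := M) (c := 4)
      (w := encList CTerm.encode (List.ofFn args) ++ w) (by decide)
      (s' := { R with
          aux := encList CTerm.encode (List.ofFn args) ++ w
          out := ((L.symCode S).flatMap fun b => [true, b]).reverse ++ true :: true :: R.out }.store e)
      (fun ys xs => { R with
          aux := encList (fun b => [b]) xs ++ (encList CTerm.encode (List.ofFn args) ++ w)
          out := (ys.flatMap fun b => [true, b]).reverse ++ true :: true :: R.out }.store e)
      (by omega) (by simp) (by simp) (by intro ys xs _; simp [hC]) (by intro ys xs _; simp)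
      ?_) fun s₁ hs₁ => ?_
    · intro ys b xs _
      cases b <;> simp [Runs, wordStep]
    simp only [Regs.store_out, Regs.update_out]
    refine Runs.wp (runs_forList (enc := CTerm.encode) (l := List.ofFn args) (M := M)
      (c := 13 * M + 21)
      (w := w) (by decide)
      (s' := { R with
          aux := w
          out := ((List.ofFn args).flatMap fun τ => true :: shiftTerm o τ).reverse ++ false ::
            (((L.symCode S).flatMap fun b => [true, b]).reverse ++ true :: true :: R.out) }.store e)
      (fun ys xs => { R with
          aux := encList CTerm.encode xs ++ w
          out := (ys.flatMap fun τ => true :: shiftTerm o τ).reverse ++ false ::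
            (((L.symCode S).flatMap fun b => [true, b]).reverse ++ true :: true :: R.out) }.store e)
      (by omega) (by simp) (by simp) (by intro ys xs _; simp [hC]) (by intro ys xs _; simp)
      ?_) fun s₂ hs₂ => ⟨?_, ?_⟩
    · intro ys τ xs hx
      have := h3 τ (by simp [hx])
      simp only [Runs, wp_seq, wp_push, Regs.update_flagC, Regs.update_aux, Regs.store_out,
        Regs.update_out]
      refine Runs.wp (runs_termStep (τ := τ) (w := encList CTerm.encode xs ++ w) (M := M)
        hD htmp ho hoM (by omega) rfl) fun s₂ hs₂ => ⟨by omega, ?_⟩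
      simp
    · have : (13 * M + 21 + 3) * M = (13 * M + 24) * M := rfl
      omega
    · simp [shiftAtom, encWord, encList_eq_flatMap]

theorem runs_matrixAll {Φ : List (CAtom L n)} (hB : R.flagB = []) (hC : R.flagC = [])
    (hD : R.flagD = []) (htmp : R.tmp = [])
    (ho : R.off = List.replicate o true) (hoM : o ≤ M) (hΦ : (encList CAtom.encode Φ).length ≤ M)
    (hinp : R.inp = encList CAtom.encode Φ) (haux : R.aux = []) :
    Runs matrixAll (R.store e)
      (((13 * M + 24) * M + 7 * M + 26 * M + 60 + 3) * M + 6 + (9 * M + 2))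
      ({ R with out := (Φ.flatMap fun α => true :: shiftAtom o α).reverse ++ R.out }.store e) := by
  simp only [Runs, matrixAll, wp_seq]
  refine (runs_copy (by decide) (by decide) (by decide) (by simpa using htmp)).wp
    fun s₁ hs₁ => ?_
  simp only [Regs.store_inp, Regs.store_aux, Regs.update_aux, haux, List.append_nil, hinp]
    at hs₁ ⊢
  have h1 := length_le_length_encList CAtom.encode Φ
  have h3 := fun α => length_enc_le_length_encList CAtom.encode (l := Φ) (x := α)
  refine Runs.wp (runs_forList (enc := CAtom.encode) (l := Φ) (M := M)
      (c := (13 * M + 24) * M + 7 * M + 26 * M + 60) (w := []) (by decide)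
      (s' := { R with
          out := (Φ.flatMap fun α => true :: shiftAtom o α).reverse ++ R.out }.store e)
      (fun ys xs => { R with
          aux := encList CAtom.encode xs
          out := (ys.flatMap fun α => true :: shiftAtom o α).reverse ++ R.out }.store e)
      (by omega) (by cases R; simp_all) (by cases R; simp_all) (by intro ys xs _; simp [hB])
      (by intro ys xs _; simp)
      ?_) fun s₂ hs₂ => ⟨?_, ?_⟩
  · intro ys α xs hx
    have := h3 α (by simp [hx])
    simp only [Regs.update_flagB, Regs.update_aux]
    refine Runs.wp (runs_atomStep (α := α) (w := encList CAtom.encode xs) (M := M)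
        hC hD htmp ho hoM (by omega) (by simp)) fun s₂ hs₂ => ⟨by omega, ?_⟩
    simp
  · omega
  · cases R
    simp_all

end

section

variable {A : Type} [Fintype A] {L : ConstraintLanguage A} {n m W : ℕ}

/-! ### The whole program -/

/-- Copies the quantifiers to register `3`, with a final `false`, and writes
one more than their number in unary on the registers `4` and `22`. -/
def readQuantifiers : Prog :=
  forList 17 0
      (.branch 0 .skip (.pop 0 ;; .push 2 false) (.pop 0 ;; .push 2 true) ;; .push 4 true ;;
        .push 22 true) ;;
    .push 2 false ;; .push 4 true ;; .push 22 true ;; move 2 3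

/-- Turns the code of a list of lists of tuples on register `7` into the code of the list of all
tuples on register `6`. -/
def flattenTuples : Prog :=
  forList 17 7 (forList 18 7 (.push 2 true ;; copyNats)) ;; .push 2 false ;; move 2 6

/-- The current tuple goes to register `9`, while the full list stays on register `6` for the
comparisons. Register `13` holds the offset `m * g` and is increased at the end by the unary `m`
kept on register `4`. -/
def tupleStep : Prog :=
  copyNats ;; move 2 9 ;; univAll ;; agreeAll ;; matrixAll ;; clear 9 ;; copy 4 13

/-- Assembles the output. -/
def finish : Prog :=
  .push 1 false ;; clear 0 ;; move 1 0 ;; .push 0 false ;;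
    .loop 13 (.pop 13 ;; .push 0 false ;; .push 0 true)

/-- The reduction, where `p` computes the adversaries. -/
def reduction (p : Prog) : Prog :=
  readQuantifiers ;; p.shift ;; move 22 2 ;; move 2 7 ;; flattenTuples ;; copy 6 7 ;;
    forList 17 7 tupleStep ;; finish

def quantBit : Quantifier → Bool
  | .all => true
  | .ex => false

variable {e : Store}

/-- The extra `false` and the extra unit belong to the dummy variable. Register `22` is register
`0`, the input, of the shifted program. -/
theorem runs_readQuantifiers {l : List Quantifier} {w : List Bool} {M : ℕ} (hl : l.length ≤ M) :
    Runs readQuantifiers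
      (({ inp := encList Quantifier.encode l ++ w } : Regs).store fun _ => [])
      ((6 + 3) * M + 6 + (4 * M + 10))
      (({ inp := w
          quants := l.map quantBit ++ [false]
          unit := List.replicate (l.length + 1) true } : Regs).store
        (Function.update (fun _ => []) 0 (List.replicate (l.length + 1) true))) := by
  simp only [Runs, readQuantifiers, wp_seq]
  refine Runs.wp (runs_forList (enc := Quantifier.encode) (l := l) (M := M)
      (c := 6) (w := w) (by decide)
      (s' := ({ inp := w
                tmp := (l.map quantBit).reverse
                unit := List.replicate l.length true } : Regs).store
        (Function.update (fun _ => []) 0 (List.replicate l.length true)))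
      (fun ys xs => ({ inp := encList Quantifier.encode xs ++ w
                       tmp := (ys.map quantBit).reverse
                       unit := List.replicate ys.length true } : Regs).store
        (Function.update (fun _ => []) 0 (List.replicate ys.length true)))
      hl (by simp) (by simp) (by intro ys xs _; simp)
      (by intro ys xs _; simp)
      ?_) fun s₂ hs₂ => ?_
  · intro ys q xs hx
    cases q <;> simp [Runs, Quantifier.encode, quantBit, List.replicate_succ]
  · simp only [wp_push, Regs.store_tmp, Regs.update_tmp, Regs.store_unit, Regs.update_unit,
      Regs.store_sub_zero, Regs.update_sub_zero]
    refine Runs.wp (runs_move (by decide) _) fun s₃ hs₃ => ⟨?_, ?_⟩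
    · simp at hs₃
      omega
    · simp [List.replicate_succ]

/-- How the tuples are grouped into adversaries plays no role in the target sentence; only their
union matters, and repetitions do no harm. -/
theorem runs_flattenTuples {l : List (List (Fin m → ℕ))} {R : Regs} {M : ℕ} (hm : m ≤ M)
    (hl : l.length ≤ M)
    (hl' : ∀ b ∈ l, b.length ≤ M) (ht : ∀ b ∈ l, ∀ t ∈ b, ∀ i, t i ≤ M)
    (hM : (encList tupleCode l.flatten).length ≤ M)
    (hA : R.flagA = []) (hB : R.flagB = []) (hC : R.flagC = []) (hD : R.flagD = [])
    (htmp : R.tmp = []) (htup : R.tuples = []) (hr : R.outer = encList (encList tupleCode) l) :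
    Runs flattenTuples (R.store e)
      ((((4 * M + 8 + 3) * M + 8 + 3) * M + 6 + 3) * M + 6 + (4 * M + 2))
      ({ R with outer := [], tuples := encList tupleCode l.flatten }.store e) := by
  simp only [Runs, flattenTuples, wp_seq]
  refine Runs.wp (runs_forList (enc := encList tupleCode) (l := l) (M := M)
      (c := ((4 * M + 8 + 3) * M + 8 + 3) * M + 6) (w := []) (by decide)
      (s' := ({ R with
                outer := []
                tmp := (l.flatten.flatMap fun t => true :: tupleCode t).reverse } : Regs).store e)
      (fun ys xs => ({ R with
                       outer := encList (encList tupleCode) xs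
                       tmp := (ys.flatten.flatMap fun t => true :: tupleCode t).reverse } :
                         Regs).store e)
      hl (by cases R; simp_all) (by simp) (by intro ys xs _; simp [hA])
      (by intro ys xs _; simp)
      ?_) fun s₁ hs₁ => ?_
  · intro ys b xs hx
    simp only [Regs.update_flagA, Regs.update_outer]
    refine runs_forList (enc := tupleCode) (l := b) (M := M)
      (c := (4 * M + 8 + 3) * M + 8) (w := encList (encList tupleCode) xs) (by decide)
      (fun ys' xs' => ({ R with
        outer := encList tupleCode xs' ++ encList (encList tupleCode) xs
        flagA := [true]
        tmp := ((ys.flatten ++ ys').flatMap fun t => true :: tupleCode t).reverse } :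
                         Regs).store e)
      (hl' b (by simp [hx])) (by simp) (by simp) (by intro ys xs _; simp [hB])
      (by intro ys xs _; simp) ?_
    intro ys' t xs' hx'
    simp only [Runs, wp_seq, wp_push, Regs.update_flagB, Regs.update_outer, Regs.store_tmp,
      Regs.update_tmp]
    refine Runs.wp (runs_copyNats (M := M) (l := List.finRange m) (k := t)
      (w := encList tupleCode xs' ++ encList (encList tupleCode) xs) (by simpa using hm)
      (fun i _ => ht b (by simp [hx]) t (by simp [hx']) i) hC hD rfl) fun s₂ hs₂ => ⟨by omega, ?_⟩
    simp [tupleCode]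
  · simp only [wp_push, Regs.store_tmp, Regs.update_tmp]
    refine Runs.wp (runs_move (by decide) _) fun s₃ hs₃ => ⟨?_, ?_⟩
    · simp only [Regs.store_tmp, List.length_cons, List.length_reverse] at hs₃
      rw [encList_eq_flatMap, List.length_append, List.length_singleton] at hM
      omega
    · simp [htup, htmp, encList_eq_flatMap]

/-- The code of the constraints for the tuple number `g`. -/
noncomputable def constraintsCode (q : Fin m → Bool) (T : Fin W → Fin m → ℕ)
    (Φ : List (CAtom L n)) (g : Fin W) : List Bool :=
  (List.finRange m).flatMap (univItem (m * g) q (T g)) ++ agreeCode T g ++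
    Φ.flatMap fun α => true :: shiftAtom (m * g) α

/-- The sum of the bounds for the parts of `tupleStep`, in their order. -/
def tupleCost (M : ℕ) : ℕ :=
  (4 * M + 8 + 3) * M + 7 + (4 * M + 1) + ((15 * M + 20 + 3) * M + 6 + 30 * M + 10) +
    (((35 * M + 57 + 3) * M + 6 + 20 * M + 20 + 3) * M + 6 + 11 * M + 3) +
    (((13 * M + 24) * M + 7 * M + 26 * M + 60 + 3) * M + 6 + (9 * M + 2)) +
    (2 * M + 1) + (9 * M + 2)

theorem runs_tupleStep {q : Fin m → Bool} {T : Fin W → Fin m → ℕ}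
    {Φ : List (CAtom L n)} {g : Fin W} {R : Regs} {M : ℕ} {w : List Bool} (hm : m ≤ M)
    (hW : W ≤ M) (hmW : m * W ≤ M) (hT : ∀ g i, T g i ≤ M)
    (hM : ∀ g, (tupleCode (T g)).length ≤ M) (hM' : (tuplesCode T).length ≤ M)
    (hΦ : (encList CAtom.encode Φ).length ≤ M)
    (hR : R = { inp := encList CAtom.encode Φ
                out := R.out
                quants := (List.finRange m).map q
                unit := List.replicate m true
                tuples := tuplesCode T
                outer := tupleCode (T g) ++ w
                off := List.replicate (m * g) true
                flagA := [true] }) :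
    Runs tupleStep (R.store e) (tupleCost M)
      ({ R with
          out := (constraintsCode q T Φ g).reverse ++ R.out
          outer := w
          off := List.replicate (m * (g + 1)) true }.store e) := by
  have hg := mul_add_le_of_fin g hmW
  generalize R.out = o at hR
  subst hR
  simp only [Runs, tupleStep, wp_seq]
  refine Runs.wp (runs_copyNats (M := M) (l := List.finRange m) (k := T g) (w := w)
    (by simpa using hm) (fun i _ => hT g i) rfl rfl rfl) fun s₁ hs₁ => ?_
  refine Runs.wp (runs_move (by decide) _) fun s₂ hs₂ => ?_
  have hMg := hM g
  have hfold : encList (fun i => encNat (T g i)) (List.finRange m) = tupleCode (T g) := rfl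
  simp only [Regs.store_tmp, Regs.store_cur, Regs.update_tmp, Regs.update_cur, hfold,
    List.append_nil, List.reverse_reverse, List.length_reverse] at hs₂ ⊢
  refine Runs.wp (runs_univAll (M := M) (q := q) (t := T g) (o := m * g) hm hg (hT g) (hM g)
    rfl rfl rfl rfl rfl rfl rfl rfl rfl rfl) fun s₃ hs₃ => ?_
  refine Runs.wp (runs_agreeAll (M := M) (T := T) (g := g) hW hmW hT hM hM'
    rfl rfl rfl rfl rfl rfl rfl rfl rfl rfl rfl rfl rfl rfl) fun s₄ hs₄ => ?_
  refine Runs.wp (runs_matrixAll (M := M) (Φ := Φ) (o := m * g)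
    rfl rfl rfl rfl rfl (by omega) hΦ rfl rfl) fun s₅ hs₅ => ?_
  refine Runs.wp (runs_clear _ _) fun s₆ hs₆ => ?_
  refine Runs.wp (runs_copy (by decide) (by decide) (by decide) (by simp)) fun s₇ hs₇ => ?_
  simp only [Regs.store_cur, Regs.update_cur, Regs.store_unit, List.length_replicate] at hs₆ hs₇
  refine ⟨?_, ?_⟩
  · unfold tupleCost
    omega
  · simp [constraintsCode, Nat.mul_succ, Nat.add_comm]

theorem runs_loop_tupleStep {q : Fin m → Bool} {T : Fin W → Fin m → ℕ}
    {Φ : List (CAtom L n)} {M : ℕ} (hm : m ≤ M)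
    (hW : W ≤ M) (hmW : m * W ≤ M) (hT : ∀ g i, T g i ≤ M)
    (hM : ∀ g, (tupleCode (T g)).length ≤ M) (hM' : (tuplesCode T).length ≤ M)
    (hΦ : (encList CAtom.encode Φ).length ≤ M) :
    Runs (forList 17 7 tupleStep)
      (({ inp := encList CAtom.encode Φ
          quants := (List.finRange m).map q
          unit := List.replicate m true
          tuples := tuplesCode T
          outer := tuplesCode T } : Regs).store e)
      ((tupleCost M + 3) * M + 6)
      (({ inp := encList CAtom.encode Φ
          out := ((List.finRange W).flatMap (constraintsCode q T Φ)).reverse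
          quants := (List.finRange m).map q
          unit := List.replicate m true
          tuples := tuplesCode T
          off := List.replicate (m * W) true } : Regs).store e) := by
  refine runs_forList (enc := fun g => tupleCode (T g)) (l := List.finRange W) (w := []) (by decide)
    (fun ys xs => ({
          inp := encList CAtom.encode Φ
          out := (ys.flatMap (constraintsCode q T Φ)).reverse
          quants := (List.finRange m).map q
          unit := List.replicate m true
          tuples := tuplesCode T
          outer := encList (fun g => tupleCode (T g)) xs
          off := List.replicate (m * ys.length) true } : Regs).store e)
    (by simpa using hW) (by simp [tuplesCode]) (by simp) (by intro ys xs _; simp)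
    (by intro ys xs _; simp) ?_
  intro ys g xs hx
  obtain ⟨hy, -⟩ := finRange_split hx
  simp only [Regs.update_flagA, Regs.update_outer]
  refine Runs.wp (runs_tupleStep (M := M) (q := q) (T := T) (Φ := Φ) (g := g)
    (w := encList (fun g => tupleCode (T g)) xs) hm hW hmW hT hM hM' hΦ (by simp [hy]))
    fun s hs => ⟨hs, ?_⟩
  simp [hy]

/-- The number of variables of the target is the final offset, known only after the last tuple, so
the quantifier prefix is put in front at the end. -/
theorem runs_finish {R : Regs} {k M : ℕ} (hoff : R.off = List.replicate k true)
    (hk : k ≤ M) (hinp : R.inp.length ≤ M) :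
    Runs finish (R.store e) (4 * R.out.length + 6 * M + 10)
      ({ R with
          inp := encList (fun _ => [false]) (List.replicate k ()) ++ (R.out.reverse ++ [false])
          out := []
          off := [] }.store e) := by
  have key : ∀ (k : ℕ) (R : Regs), R.off = List.replicate k true →
      Runs (.loop 13 (.pop 13 ;; .push 0 false ;; .push 0 true)) (R.store e) (4 * k + 1)
      ({ R with
          inp := (List.replicate k ()).flatMap (fun _ => [true, false]) ++ R.inp
          off := [] }.store e) := by
    intro k
    induction k with
    | zero => exact fun R h => wp_loop_of_eq_nil (by simpa using h) ⟨by simp, by cases R; simp_all⟩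
    | succ k ih =>
      intro R h
      refine wp_loop_of_ne_nil (by simp [h]) ?_
      simp only [wp_seq, wp_pop, wp_push, Regs.store_off, Regs.update_off, Regs.store_inp,
        Regs.update_inp, h, List.replicate_succ, List.tail_cons]
      refine Runs.wp (ih _ rfl) fun s hs => ⟨by omega, ?_⟩
      have : ∀ k, (List.replicate k ()).flatMap (fun _ => [true, false]) ++ [true, false] =
          [true, false] ++ (List.replicate k ()).flatMap (fun _ => [true, false]) := by
        intro k
        induction k with
        | zero => rfl
        | succ k ih => simp only [List.replicate_succ, List.flatMap_cons, List.append_assoc, ih]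
      have h' := congrArg (· ++ R.inp) (this k)
      simp only [List.append_assoc, List.cons_append, List.nil_append] at h'
      simp [h']
  simp only [Runs, finish, wp_seq, wp_push, Regs.store_out, Regs.update_out]
  refine Runs.wp (runs_clear _ _) fun s₁ hs₁ => Runs.wp (runs_move (by decide) _) fun s₂ hs₂ => ?_
  simp only [Regs.store_inp, Regs.update_inp, Regs.store_out, Regs.update_out, List.append_nil,
    List.length_cons] at hs₁ hs₂ ⊢
  refine Runs.wp (key k _ hoff) fun s₃ hs₃ => ⟨by omega, ?_⟩
  simp [encList_eq_flatMap]

end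

/-! ### Strategies -/

/-- A quantified sentence holds if and only if there is a strategy `F` that turns the values
chosen by the opponent (those of the existential variables are ignored) into values of all
variables, where the value of a variable depends only on the choices made before. -/
theorem prefixHolds_iff_exists_strategy {A : Type} [Nonempty A] {n : ℕ} {q : Fin n → Quantifier}
    {P : (Fin n → A) → Prop} :
    PrefixHolds n q P ↔ ∃ F : (Fin n → A) → Fin n → A,
      (∀ i x y, (∀ j ≤ i, x j = y j) → F x i = F y i) ∧
      (∀ i, q i = Quantifier.all → ∀ x, F x i = x i) ∧ ∀ x, P (F x) := by
  induction n with
  | zero =>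
    constructor
    · exact fun h => ⟨fun x => x, fun i => i.elim0, fun i => i.elim0, fun x => by
        rwa [Subsingleton.elim x Fin.elim0]⟩
    · rintro ⟨F, -, -, h⟩
      have := h Fin.elim0
      rwa [Subsingleton.elim (F Fin.elim0) Fin.elim0] at this
  | succ n ih =>
    -- Shared by both quantifiers: once the first move `a` is fixed and the first answer is a
    -- constant `b`, the tail of the strategy plays the remaining game.
    have back : ∀ (F : (Fin (n + 1) → A) → Fin (n + 1) → A) (a : A) (b : A),
        (∀ i x y, (∀ j ≤ i, x j = y j) → F x i = F y i) →
        (∀ i, q i = Quantifier.all → ∀ x, F x i = x i) → (∀ x, P (F x)) →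
        (∀ y, F (Fin.cons a y) 0 = b) →
        PrefixHolds n (Fin.tail q) (fun v => P (Fin.cons b v)) := by
      intro F a b h₁ h₂ h₃ h₄
      refine ih.2 ⟨fun y => Fin.tail (F (Fin.cons a y)), fun i x y h => h₁ _ _ _ fun j hj => ?_,
        fun i hi x => ?_, fun x => ?_⟩
      · refine Fin.cases (fun _ => rfl) (fun j hj => ?_) j hj
        simpa using h j (Fin.succ_le_succ_iff.1 hj)
      · exact (h₂ i.succ hi _).trans (Fin.cons_succ _ _ _)
      · rw [← h₄ x, show Fin.cons (F (Fin.cons a x) 0) (Fin.tail (F (Fin.cons a x))) =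
          F (Fin.cons a x) from Fin.cons_self_tail _]
        exact h₃ _
    cases hq : q 0 with
    | all =>
      simp only [PrefixHolds, hq]
      constructor
      · intro h
        choose F h₁ h₂ h₃ using fun a => ih.1 (h a)
        refine ⟨fun x => Fin.cons (x 0) (F (x 0) (Fin.tail x)), fun i x y h => ?_, fun i hi x => ?_,
          fun x => h₃ _ _⟩
        · induction i using Fin.cases with
          | zero => simpa using h 0 le_rfl
          | succ i =>
            simp only [Fin.cons_succ, h 0 (Fin.zero_le _)]
            exact h₁ _ _ _ _ fun j hj => h j.succ (Fin.succ_le_succ_iff.2 hj)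
        · induction i using Fin.cases with
          | zero => rfl
          | succ i => exact h₂ _ i hi _
      · rintro ⟨F, h₁, h₂, h₃⟩ a
        exact back F a a h₁ h₂ h₃ fun y => h₂ 0 hq _
    | ex =>
      simp only [PrefixHolds, hq]
      constructor
      · rintro ⟨a, h⟩
        obtain ⟨F, h₁, h₂, h₃⟩ := ih.1 h
        refine ⟨fun x => Fin.cons a (F (Fin.tail x)), fun i x y h => ?_, fun i hi x => ?_,
          fun x => h₃ _⟩
        · induction i using Fin.cases with
          | zero => rfl
          | succ i => exact h₁ _ _ _ fun j hj => h j.succ (Fin.succ_le_succ_iff.2 hj)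
        · induction i using Fin.cases with
          | zero => rw [hq] at hi; cases hi
          | succ i => exact h₂ i hi _
      · rintro ⟨F, h₁, h₂, h₃⟩
        obtain ⟨a⟩ := ‹Nonempty A›
        -- The opponent's move at an existential variable is irrelevant, so it is fixed arbitrarily;
        -- the first answer depends on nothing else.
        refine ⟨F (Fin.cons a fun _ => a) 0, back F a _ h₁ h₂ h₃ fun y => h₁ _ _ _ fun j hj => ?_⟩
        obtain rfl : j = 0 := by simpa using hj
        rfl

theorem prefixHolds_ex {A : Type} {n : ℕ} {q : Fin n → Quantifier} (hq : ∀ i, q i = .ex)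
    {P : (Fin n → A) → Prop} : PrefixHolds n q P ↔ ∃ v, P v := by
  induction n with
  | zero =>
    exact ⟨fun h => ⟨_, h⟩, fun ⟨v, h⟩ => by
      rwa [Subsingleton.elim v Fin.elim0] at h⟩
  | succ n ih =>
    simp only [PrefixHolds, hq 0]
    constructor
    · rintro ⟨a, h⟩
      obtain ⟨v, h⟩ := (ih fun i => hq i.succ).1 h
      exact ⟨_, h⟩
    · rintro ⟨v, h⟩
      exact ⟨v 0, (ih fun i => hq i.succ).2 ⟨Fin.tail v, by
        rwa [show Fin.cons (v 0) (Fin.tail v) = v from Fin.cons_self_tail v]⟩⟩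

section

variable {A : Type} {L : ConstraintLanguage A} {n W : ℕ}

theorem CTerm.value_polymorphism {k : ℕ} {f : (Fin k → A) → A} (hf : IsPolymorphism L f)
    (v : Fin k → Fin n → A) (τ : CTerm L n) :
    τ.value (fun i => f fun l => v l i) = f fun l => τ.value (v l) := by
  cases τ with
  | var i => rfl
  | const a h => exact (hf.2 a h).symm

/-- Solutions are closed under polymorphisms. Constants inside atoms are harmless since
polymorphisms fix them. -/
theorem CAtom.holds_polymorphism {k : ℕ} {f : (Fin k → A) → A} (hf : IsPolymorphism L f)
    {v : Fin k → Fin n → A} {α : CAtom L n} (h : ∀ l, α.Holds (v l)) :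
    α.Holds (fun i => f fun l => v l i) := by
  cases α with
  | eq s t =>
    simp only [CAtom.Holds, CTerm.value_polymorphism hf] at h ⊢
    simp only [h]
  | rel R args =>
    simp only [CAtom.Holds, CTerm.value_polymorphism hf] at h ⊢
    exact hf.1 R _ h

/-- A sentence holds if and only if there is a strategy against the opponents that play one of
finitely many tuples `T g`, provided that these generate all tuples in the projective way. The
last coordinate of the tuples is ignored. -/
theorem holds_iff_exists_assignment [Nonempty A] (φ : PHSentence L)
    (T : Fin W → Fin (φ.numVars + 1) → A)
    (hT : ∃ (k : ℕ) (f : (Fin k → A) → A) (s : Fin k → Fin (φ.numVars + 1) → A → A),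
      IsPolymorphism L f ∧ (∀ i a, f (fun l => s l i a) = a) ∧
      ∀ l (x : Fin (φ.numVars + 1) → A), ∃ g, T g = fun i => s l i (x i)) :
    φ.Holds ↔ ∃ v : Fin W → Fin (φ.numVars + 1) → A,
      (∀ g i, φ.quant i = Quantifier.all → v g i.castSucc = T g i.castSucc) ∧
      (∀ g g' i, (∀ j ≤ i, T g j = T g' j) → v g i = v g' i) ∧
      ∀ g, ∀ α ∈ φ.matrix, α.Holds fun i => v g i.castSucc := by
  have a : A := Classical.arbitrary A
  refine prefixHolds_iff_exists_strategy.trans ⟨?_, ?_⟩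
  · rintro ⟨F, h₁, h₂, h₃⟩
    refine ⟨fun g => Fin.snoc (F fun i => T g i.castSucc) a, fun g i hi => ?_,
      fun g g' i h => ?_, fun g α hα => ?_⟩
    · simpa using h₂ i hi _
    · induction i using Fin.lastCases with
      | last => simp
      | cast i =>
        simpa using h₁ _ _ _ fun j hj => h j.castSucc (Fin.castSucc_le_castSucc_iff.2 hj)
    · simpa using h₃ (fun i => T g i.castSucc) α hα
  · rintro ⟨v, h₁, h₂, h₃⟩
    obtain ⟨k, f, s, hf, hs, hT⟩ := hT
    choose g hg using hT
    have hg' : ∀ l x i, T (g l x) i = s l i (x i) := fun l x i => congrFun (hg l x) i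
    let ext : (Fin φ.numVars → A) → Fin (φ.numVars + 1) → A := fun x => Fin.snoc x a
    -- The play `x` is answered by `f` applied to the answers recorded for the `k` tuples `T (g l
    -- x)`, which `f` sends to the extension of `x`.
    refine ⟨fun x i => f fun l => v (g l (ext x)) i.castSucc, fun i x y h => ?_, fun i hi x => ?_,
      fun x α hα => ?_⟩
    -- Coordinate `j` of `T (g l x)` depends on `x` through `x j` alone. Plays that agree up to `i`
    -- therefore give tuples that agree up to `i`, for which the recorded answers coincide. The
    -- dummy coordinate lies beyond `i` and does not interfere.
    · refine congrArg f (funext fun l => h₂ _ _ _ fun j hj => ?_)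
      have hj' : j ≠ Fin.last _ := (hj.trans_lt (Fin.castSucc_lt_last i)).ne
      obtain ⟨j, rfl⟩ := Fin.exists_castSucc_eq.2 hj'
      simp only [hg', ext, Fin.snoc_castSucc, h j (Fin.castSucc_le_castSucc_iff.1 hj)]
    · simp only [h₁ _ _ hi, hg', hs, ext, Fin.snoc_castSucc]
    · exact CAtom.holds_polymorphism hf fun l => h₃ _ α hα

/-! ### The target sentence -/

def CTerm.relabel {n N : ℕ} {C : Set A} (ρ : Fin n → Fin N) :
    CTerm L n → CTerm (L.withConstants C) N
  | .var i => .var (ρ i)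
  | .const a h => .const a (Or.inl h)

def CAtom.relabel {n N : ℕ} {C : Set A} (ρ : Fin n → Fin N) :
    CAtom L n → CAtom (L.withConstants C) N
  | .eq s t => .eq (s.relabel ρ) (t.relabel ρ)
  | .rel R args => .rel (L := L.withConstants C) R fun i => (args i).relabel ρ

theorem CTerm.value_relabel {N : ℕ} {C : Set A} (ρ : Fin n → Fin N) (v : Fin N → A)
    (τ : CTerm L n) : (τ.relabel ρ : CTerm (L.withConstants C) N).value v =
      τ.value fun i => v (ρ i) := by
  cases τ <;> rfl

theorem CAtom.holds_relabel {N : ℕ} {C : Set A} (ρ : Fin n → Fin N) (v : Fin N → A)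
    (α : CAtom L n) : (α.relabel ρ : CAtom (L.withConstants C) N).Holds v ↔
      α.Holds fun i => v (ρ i) := by
  cases α with
  | eq s t => simp only [CAtom.relabel, CAtom.Holds, CTerm.value_relabel]
  | rel R args =>
    simp only [CAtom.relabel, CAtom.Holds, CTerm.value_relabel]
    rfl

variable [Fintype A]

/-- The numbers of the elements of a tuple. -/
noncomputable def numbers {m : ℕ} (t : Fin m → A) (i : Fin m) : ℕ := Fintype.equivFin A (t i)

/-- The program compares numbers instead of elements; using them in `constraints` also makes the
condition there decidable. -/
theorem numbers_eq_iff {m m' : ℕ} {t : Fin m → A} {t' : Fin m' → A} {i : Fin m} {j : Fin m'} :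
    numbers t i = numbers t' j ↔ t i = t' j := by
  simp [numbers, Fin.val_inj]

/-- Which of the variables are universal; there is a dummy variable at the end. -/
def universalBit (φ : PHSentence L) : Fin (φ.numVars + 1) → Bool :=
  Fin.snoc (fun i => quantBit (φ.quant i)) false

/-- The constraints for the tuple number `g`. -/
noncomputable def constraints (φ : PHSentence L) (C : Set A)
    (T : Fin W → Fin (φ.numVars + 1) → A) (hT : ∀ g i, T g i ∈ L.consts ∪ C) (g : Fin W) :
    List (CAtom (L.withConstants C) (W * (φ.numVars + 1))) :=
  ((List.finRange (φ.numVars + 1)).flatMap fun i =>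
    if universalBit φ i then
      [.eq (.var (finProdFinEquiv (g, i))) (.const (T g i) (hT g i))] else []) ++
  ((List.finRange W).flatMap fun g' => (List.finRange (φ.numVars + 1)).flatMap fun i =>
    if ∀ j ≤ i, numbers (T g) j = numbers (T g') j then
      [.eq (.var (finProdFinEquiv (g, i))) (.var (finProdFinEquiv (g', i)))] else []) ++
  φ.matrix.map (CAtom.relabel fun i => finProdFinEquiv (g, i.castSucc))

/-- The primitive positive sentence that describes a strategy against the tuples `T g`. -/
noncomputable def targetSentence (φ : PHSentence L) (C : Set A)
    (T : Fin W → Fin (φ.numVars + 1) → A) (hT : ∀ g i, T g i ∈ L.consts ∪ C) :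
    PHSentence (L.withConstants C) where
  numVars := W * (φ.numVars + 1)
  quant _ := .ex
  matrix := (List.finRange W).flatMap (constraints φ C T hT)

/-- An assignment to `W * (n + 1)` variables, with `n = φ.numVars`, is a family of `W` assignments
through `finProdFinEquiv`, and the three kinds of constraints are the three conditions. -/
theorem holds_targetSentence (φ : PHSentence L) (C : Set A)
    (T : Fin W → Fin (φ.numVars + 1) → A) (hT : ∀ g i, T g i ∈ L.consts ∪ C) :
    (targetSentence φ C T hT).Holds ↔ ∃ v : Fin W → Fin (φ.numVars + 1) → A,
      (∀ g i, φ.quant i = Quantifier.all → v g i.castSucc = T g i.castSucc) ∧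
      (∀ g g' i, (∀ j ≤ i, T g j = T g' j) → v g i = v g' i) ∧
      ∀ g, ∀ α ∈ φ.matrix, α.Holds fun i => v g i.castSucc := by
  have key : ∀ v : Fin (W * (φ.numVars + 1)) → A,
      (∀ α ∈ (List.finRange W).flatMap (constraints φ C T hT), α.Holds v) ↔
      (∀ g i, φ.quant i = Quantifier.all → v (finProdFinEquiv (g, i.castSucc)) = T g i.castSucc) ∧
      (∀ g g' i, (∀ j ≤ i, T g j = T g' j) →
        v (finProdFinEquiv (g, i)) = v (finProdFinEquiv (g', i))) ∧
      ∀ g, ∀ α ∈ φ.matrix, α.Holds fun i => v (finProdFinEquiv (g, i.castSucc)) := by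
    intro v
    have h1 : ∀ i, universalBit φ i = true ↔ ∃ j, i = Fin.castSucc j ∧ φ.quant j = .all := by
      intro i
      induction i using Fin.lastCases with
      | last => simp [universalBit, (Fin.castSucc_ne_last _).symm]
      | cast i => cases h : φ.quant i <;> simp [universalBit, h, quantBit]
    simp only [constraints, List.mem_flatMap, List.mem_append, List.mem_map,
      List.mem_finRange, true_and, numbers_eq_iff, List.mem_ite_nil_right, List.mem_singleton, h1]
    constructor
    · intro h
      refine ⟨fun g i hi => ?_, fun g g' i hi => ?_, fun g α hα => ?_⟩
      · exact h _ ⟨g, .inl (.inl ⟨i.castSucc, ⟨i, rfl, hi⟩, rfl⟩)⟩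
      · exact h _ ⟨g, .inl (.inr ⟨g', i, hi, rfl⟩)⟩
      · exact (CAtom.holds_relabel (C := C) _ _ _).1 (h _ ⟨g, .inr ⟨α, hα, rfl⟩⟩)
    · rintro ⟨h₁, h₂, h₃⟩ _ ⟨g, (⟨_, ⟨i, rfl, hi⟩, rfl⟩ | ⟨g', i, hi, rfl⟩) | ⟨α, hα, rfl⟩⟩
      · exact h₁ g i hi
      · exact h₂ g g' i hi
      · exact (CAtom.holds_relabel (C := C) _ _ _).2 (h₃ g α hα)
  refine (prefixHolds_ex fun _ => rfl).trans ?_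
  constructor
  · rintro ⟨v, h⟩
    exact ⟨fun g i => v (finProdFinEquiv (g, i)), (key v).1 h⟩
  · rintro ⟨v, h⟩
    refine ⟨fun j => v (finProdFinEquiv.symm j).1 (finProdFinEquiv.symm j).2, (key _).2 ?_⟩
    simpa only [Equiv.symm_apply_apply] using h

/-! ### The code of the target sentence -/

theorem CTerm.encode_relabel {N : ℕ} {C : Set A} {ρ : Fin n → Fin N} {o : ℕ}
    (hρ : ∀ i, (ρ i : ℕ) = o + i) (τ : CTerm L n) :
    (τ.relabel ρ : CTerm (L.withConstants C) N).encode = shiftTerm o τ := by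
  cases τ <;> simp [CTerm.relabel, CTerm.encode, shiftTerm, varCode, hρ]

theorem CAtom.encode_relabel {N : ℕ} {C : Set A} {ρ : Fin n → Fin N} {o : ℕ}
    (hρ : ∀ i, (ρ i : ℕ) = o + i) (α : CAtom L n) :
    (α.relabel ρ : CAtom (L.withConstants C) N).encode = shiftAtom o α := by
  cases α with
  | eq s t => simp only [CAtom.relabel, CAtom.encode, shiftAtom, CTerm.encode_relabel hρ]
  | rel R args =>
    have h : ∀ l : List (CTerm L n), encList CTerm.encode
        (l.map (CTerm.relabel ρ : _ → CTerm (L.withConstants C) N)) = encList (shiftTerm o) l := by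
      intro l
      induction l with
      | nil => rfl
      | cons τ l ih => simp only [List.map_cons, encList, ih, CTerm.encode_relabel hρ]
    simp only [shiftAtom, ← h, List.map_ofFn]
    rfl

/-- Links the semantics with the program: variable `i` of copy `g` has number `m * g + i`, where `m
= φ.numVars + 1`, so relabelling into a copy is the shift by an offset that the program carries out.
-/
theorem encode_targetSentence (φ : PHSentence L) (C : Set A)
    (T : Fin W → Fin (φ.numVars + 1) → A) (hT : ∀ g i, T g i ∈ L.consts ∪ C) :
    (targetSentence φ C T hT).encode =
      encList (fun _ => [false]) (List.replicate ((φ.numVars + 1) * W) ()) ++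
        ((List.finRange W).flatMap
          (constraintsCode (universalBit φ) (fun g => numbers (T g)) φ.matrix) ++ [false]) := by
  have hq : ∀ k : ℕ, encList Quantifier.encode (List.replicate k Quantifier.ex) =
      encList (fun _ => [false]) (List.replicate k ()) := by
    intro k
    induction k with
    | zero => rfl
    | succ k ih => simp only [List.replicate_succ, encList, ih, Quantifier.encode]
  have hidx : ∀ (g : Fin W) (i : Fin (φ.numVars + 1)),
      (finProdFinEquiv (g, i) : ℕ) = (φ.numVars + 1) * g + i := fun g i => Nat.add_comm _ _
  have hc : ∀ g, (constraints φ C T hT g).flatMap (fun α => true :: α.encode) =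
      constraintsCode (universalBit φ) (fun g => numbers (T g)) φ.matrix g := by
    intro g
    simp only [constraints, constraintsCode, List.flatMap_append, agreeCode, List.flatMap_assoc,
      List.flatMap_map]
    congr 2
    · congr 1
      · funext i
        split_ifs with h <;> simp [univItem, h, CAtom.encode, CTerm.encode, varCode, hidx, encElem,
          numbers]
    · congr 1
      funext g'
      congr 1
      funext i
      unfold agreeItem
      split_ifs with h <;> simp [CAtom.encode, CTerm.encode, varCode, hidx]
    · funext α
      rw [CAtom.encode_relabel (o := (φ.numVars + 1) * g) fun i => by rw [hidx]; rfl]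
  unfold PHSentence.encode
  congr 1
  · rw [show List.ofFn (targetSentence φ C T hT).quant = _ from List.ofFn_const _ _, hq,
      ← Nat.mul_comm W]
    rfl
  · rw [encList_eq_flatMap]
    simp only [targetSentence, List.flatMap_assoc, hc]

end

/-! ### Polynomial bounds -/

/-- Functions given by polynomials. -/
def IsPolynomial (f : ℕ → ℕ) : Prop := ∃ q : Polynomial ℕ, ∀ x, q.eval x = f x

namespace IsPolynomial

theorem id : IsPolynomial fun x => x := ⟨.X, fun _ => Polynomial.eval_X⟩

theorem const (c : ℕ) : IsPolynomial fun _ => c := ⟨.C c, fun _ => Polynomial.eval_C⟩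

theorem add {f g : ℕ → ℕ} : IsPolynomial f → IsPolynomial g → IsPolynomial fun x => f x + g x
  | ⟨p, hp⟩, ⟨q, hq⟩ => ⟨p + q, fun x => by rw [Polynomial.eval_add, hp, hq]⟩

theorem mul {f g : ℕ → ℕ} : IsPolynomial f → IsPolynomial g → IsPolynomial fun x => f x * g x
  | ⟨p, hp⟩, ⟨q, hq⟩ => ⟨p * q, fun x => by rw [Polynomial.eval_mul, hp, hq]⟩

theorem comp {f g : ℕ → ℕ} : IsPolynomial f → IsPolynomial g → IsPolynomial fun x => f (g x)
  | ⟨p, hp⟩, ⟨q, hq⟩ => ⟨p.comp q, fun x => by rw [Polynomial.eval_comp, hq, hp]⟩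

end IsPolynomial

theorem Polynomial.eval_mono_nat (p : Polynomial ℕ) {x y : ℕ} (h : x ≤ y) :
    p.eval x ≤ p.eval y := by
  simp only [Polynomial.eval_eq_sum_range]
  exact Finset.sum_le_sum fun i _ => Nat.mul_le_mul_left _ (Nat.pow_le_pow_left h i)

theorem isPolynomial_tupleCost : IsPolynomial tupleCost := by
  unfold tupleCost
  repeat' first | exact IsPolynomial.const _ | exact IsPolynomial.id | apply IsPolynomial.add |
    apply IsPolynomial.mul

/-- A bound for the running time of the reduction. -/
def reductionCost (M : ℕ) : ℕ :=
  ((6 + 3) * M + 6 + (4 * M + 10)) + M + (4 * M + 1) + (4 * M + 1) +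
    ((((4 * M + 8 + 3) * M + 8 + 3) * M + 6 + 3) * M + 6 + (4 * M + 2)) + (9 * M + 2) +
    ((tupleCost M + 3) * M + 6) + (4 * ((tupleCost M + 3) * M + 6) + 6 * M + 10)

theorem isPolynomial_reductionCost : IsPolynomial reductionCost := by
  unfold reductionCost
  repeat' first | exact IsPolynomial.const _ | exact IsPolynomial.id |
    exact isPolynomial_tupleCost | apply IsPolynomial.add | apply IsPolynomial.mul

/-! ### Correctness of the program -/

theorem encList_map {α β : Type} (enc : β → List Bool) (f : α → β) (l : List α) :
    encList enc (l.map f) = encList (fun x => enc (f x)) l := by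
  induction l with
  | nil => rfl
  | cons x l ih => simp only [List.map_cons, encList, ih]

theorem length_encList_flatten_le {α : Type} (enc : α → List Bool) (l : List (List α)) :
    (encList enc l.flatten).length ≤ (encList (encList enc) l).length := by
  induction l with
  | nil => rfl
  | cons b l ih =>
    simp only [encList_eq_flatMap, List.flatten_cons, List.flatMap_append, List.length_append,
      List.flatMap_cons, List.length_cons] at ih ⊢
    omega

theorem mul_length_le_length_encList {α : Type} {enc : α → List Bool} {l : List α} {c : ℕ}
    (h : ∀ x ∈ l, c ≤ (enc x).length) : c * l.length ≤ (encList enc l).length := by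
  induction l with
  | nil => simp
  | cons x l ih =>
    have h1 := ih fun y hy => h y (List.mem_cons_of_mem _ hy)
    have h2 := h x List.mem_cons_self
    simp only [encList, List.length_cons, List.length_append, Nat.mul_succ]
    omega

/-- Bounds the length of the assembled output by the running time, without computing it. -/
theorem Runs.length_le {p : Prog} {s s' : Store} {T : ℕ} (h : Runs p s T s') (r : ℕ) :
    (s' r).length ≤ (s r).length + T := by
  obtain ⟨t, _, h, ht, rfl⟩ := h
  have := h.length_le r
  omega

theorem update_nil_eq_store (x : List Bool) :
    Function.update (fun _ => []) 0 x = ({ inp := x } : Regs).store fun _ => [] := by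
  have h : (fun _ => []) = ({} : Regs).store fun _ => [] :=
    funext fun r => by unfold Regs.store; split <;> rfl
  exact (congrArg (Function.update · 0 x) h).trans (Regs.update_inp _ _ _)

theorem map_universalBit {A : Type} {L : ConstraintLanguage A} (φ : PHSentence L) :
    (List.ofFn φ.quant).map quantBit ++ [false] =
      (List.finRange (φ.numVars + 1)).map (universalBit φ) := by
  rw [List.finRange_succ_last, List.map_append, List.ofFn_eq_map, List.map_map, List.map_map]
  simp [universalBit, Function.comp_def]

section

variable {A : Type} [Fintype A] {L : ConstraintLanguage A} {m W : ℕ}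

theorem tupleCode_numbers (t : Fin m → A) :
    tupleCode (numbers t) = encList encElem (List.ofFn t) := by
  rw [List.ofFn_eq_map, encList_map]
  rfl

theorem outputsWithin_reduction (φ : PHSentence L) {p : Prog}
    {l : List (List (Fin (φ.numVars + 1) → A))} {t M : ℕ} {e : Store}
    (hp : Exec p (Function.update (fun _ => []) 0 (List.replicate (φ.numVars + 1) true)) t e)
    (he : e 0 = encList (encList fun t => encList encElem (List.ofFn t)) l)
    (hM : φ.encode.length + (φ.numVars + 1) + t ≤ M) {C : Set A}
    {T : Fin W → Fin (φ.numVars + 1) → A} (hl : l.flatten = List.ofFn T)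
    (hT : ∀ g i, T g i ∈ L.consts ∪ C) :
    OutputsWithin (reduction p) φ.encode (targetSentence φ C T hT).encode (reductionCost M) := by
  set ν := l.map (List.map numbers) with hν
  have hraw : e 0 = encList (encList tupleCode) ν := by
    simp only [he, hν, encList_map, tupleCode_numbers]
  have hflat : encList tupleCode ν.flatten = tuplesCode fun g => numbers (T g) := by
    rw [hν, ← List.map_flatten, hl, List.ofFn_eq_map, List.map_map, encList_map]
    rfl
  -- The enumeration starts with `φ.numVars + 1` bits and makes `t` steps, so its output has at most
  -- `M` bits. The numbers, tuples and loop lengths below are bounded by this code.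
  have hlen := hp.length_le 0
  rw [hraw, Function.update_self, List.length_replicate] at hlen
  have h1 : φ.encode.length = (encList Quantifier.encode (List.ofFn φ.quant)).length +
      (encList CAtom.encode φ.matrix).length := List.length_append
  have h2 := length_le_length_encList Quantifier.encode (List.ofFn φ.quant)
  have h3 := length_le_length_encList (encList tupleCode) ν
  have h4 : ∀ b ∈ ν, (encList tupleCode b).length < (encList (encList tupleCode) ν).length :=
    fun b => length_enc_le_length_encList (encList tupleCode)
  have h5 := length_encList_flatten_le tupleCode ν
  have h6 : ∀ (t : Fin (φ.numVars + 1) → ℕ) i, t i < (tupleCode t).length := fun t i =>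
    (Nat.lt_succ_self _).trans ((length_encNat (t i)).symm.trans_lt
      (length_enc_le_length_encList (fun i => encNat (t i)) (List.mem_finRange i)))
  have h7 : ∀ t : Fin (φ.numVars + 1) → ℕ, φ.numVars + 1 ≤ (tupleCode t).length := fun t =>
    (List.length_finRange).symm.trans_le (length_le_length_encList _ _)
  -- Every tuple contributes at least one bit per coordinate, so the number of target variables is
  -- at most the length of the code.
  have h8 : (φ.numVars + 1) * W ≤ (tuplesCode fun g => numbers (T g)).length := by
    have h := mul_length_le_length_encList (l := List.finRange W)
      (enc := fun g => tupleCode (numbers (T g))) fun g _ => h7 _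
    rwa [List.length_finRange] at h
  have h9 : W ≤ (φ.numVars + 1) * W := Nat.le_mul_of_pos_left _ (Nat.succ_pos _)
  have h10 : ∀ g, (tupleCode (numbers (T g))).length < (tuplesCode fun g => numbers (T g)).length :=
    fun g => length_enc_le_length_encList (fun g => tupleCode (numbers (T g)))
      (List.mem_finRange g)
  rw [hflat] at h5
  suffices h : Runs (reduction p) (Function.update (fun _ => []) 0 φ.encode) (reductionCost M)
      (({ inp := (targetSentence φ C T hT).encode
          quants := (List.finRange (φ.numVars + 1)).map (universalBit φ)
          unit := List.replicate (φ.numVars + 1) true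
          tuples := tuplesCode fun g => numbers (T g) } : Regs).store
        (Function.update e 0 [])) by
    obtain ⟨t, s, h, ht, rfl⟩ := h
    exact ⟨t, ht, _, h, rfl⟩
  rw [update_nil_eq_store]
  simp only [Runs, reduction, wp_seq]
  refine Runs.wp (runs_readQuantifiers (M := M) (l := List.ofFn φ.quant)
    (w := encList CAtom.encode φ.matrix) (by omega)) fun s₁ hs₁ => ?_
  rw [List.length_ofFn, map_universalBit]
  refine ⟨t, _, hp.shift _, ?_⟩
  refine Runs.wp (runs_move (by decide) _) fun s₂ hs₂ => ?_
  simp only [Regs.store_sub_zero, Regs.store_tmp, Regs.update_tmp, Regs.update_sub_zero,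
    List.append_nil, hraw] at hs₂ ⊢
  refine Runs.wp (runs_move (by decide) _) fun s₃ hs₃ => ?_
  simp only [Regs.store_tmp, Regs.update_tmp, Regs.store_outer, Regs.update_outer,
    List.append_nil, List.reverse_reverse, List.length_reverse] at hs₃ ⊢
  refine Runs.wp (runs_flattenTuples (l := ν) (M := M) (by omega) (by omega)
    (fun b hb => ?_) (fun b hb t ht i => ?_) (by rw [hflat]; omega) rfl rfl rfl rfl rfl rfl rfl)
    fun s₄ hs₄ => ?_
  · have := length_le_length_encList tupleCode b
    have := h4 b hb
    omega
  · have := length_enc_le_length_encList tupleCode ht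
    have := h4 b hb
    have := h6 t i
    omega
  refine Runs.wp (runs_copy (by decide) (by decide) (by decide) (by simp)) fun s₅ hs₅ => ?_
  simp only [Regs.store_tuples, Regs.store_outer, Regs.update_outer, List.append_nil, hflat]
    at hs₅ ⊢
  have hloop := runs_loop_tupleStep (e := Function.update e 0 []) (M := M)
    (q := universalBit φ) (T := fun g => numbers (T g)) (Φ := φ.matrix) (by omega) (by omega)
    (by omega) (fun g i => by have := h6 (numbers (T g)) i; have := h10 g; omega)
    (fun g => by have := h10 g; omega) (by omega) (by omega)
  have hout := hloop.length_le 1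
  refine Runs.wp hloop fun s₆ hs₆ => ?_
  refine Runs.wp (runs_finish (k := (φ.numVars + 1) * W) (M := M) rfl (by omega) (by simp only; omega))
    fun s₇ hs₇ => ⟨?_, ?_⟩
  · simp only [Regs.store_out, List.length_nil] at hout hs₇
    unfold reductionCost
    omega
  · simp [encode_targetSentence]

/-! ### The reduction -/

theorem polyReducesTo_of_generates {Ω : (m : ℕ) → Finset (Adversary A m)}
    (hnondeg : ∀ m ≥ 1, Nondegenerate (Ω m)) (heff : Effective Ω) (hproj : Projective Ω)
    (hpoly : PolynomiallyBounded Ω) (hgen : ∀ m ≥ 1, Generates L (Ω m) Set.univ) {C : Set A}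
    (hC : ∀ m ≥ 1, ∀ B ∈ Ω m, ∀ t ∈ B, ∀ i, t i ∈ L.consts ∪ C) :
    (QCSP L).PolyReducesTo (CSP (L.withConstants C)) := by
  classical
  have hA : Nonempty A := by
    -- Nondegeneracy at length 2 supplies a tuple, hence an element of the domain.
    obtain ⟨-, -, μ, -, -⟩ := hnondeg 2 (by norm_num) 0 1 (by decide)
    exact ⟨μ 0⟩
  obtain ⟨p', prog, heff⟩ := heff
  obtain ⟨p, hp⟩ := hpoly
  choose l hl hout using heff
  have hmem : ∀ m (hm : m ≥ 1) t, t ∈ (l m hm).flatten ↔ ∃ B ∈ Ω m, t ∈ B := by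
    intro m hm t
    constructor
    · intro h
      obtain ⟨b, hb, ht⟩ := List.mem_flatten.1 h
      exact ⟨b.toFinset, (hl m hm _).2 ⟨b, hb, by simp⟩, by simpa using ht⟩
    · rintro ⟨B, hB, ht⟩
      obtain ⟨b, hb, h⟩ := (hl m hm B).1 hB
      exact List.mem_flatten.2 ⟨b, hb, (h t).1 ht⟩
  let T : (φ : PHSentence L) → Fin (l (φ.numVars + 1) (Nat.succ_pos _)).flatten.length →
    Fin (φ.numVars + 1) → A := fun φ => (l (φ.numVars + 1) (Nat.succ_pos _)).flatten.get
  have hT : ∀ φ g i, T φ g i ∈ L.consts ∪ C := by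
    intro φ g i
    obtain ⟨B, hB, h⟩ := (hmem _ (Nat.succ_pos _) _).1 (List.get_mem _ g)
    exact hC _ (Nat.succ_pos _) B hB _ h i
  -- The bound `M` is `|φ| + |φ| + p' (p |φ|)`, for the input, the length `m ≤ |φ|` and the time of
  -- the enumeration.
  obtain ⟨q, hq⟩ := isPolynomial_reductionCost.comp
    ((IsPolynomial.id.add IsPolynomial.id).add ⟨p'.comp p, fun _ => rfl⟩)
  refine ⟨fun φ => ⟨targetSentence φ C (T φ) (hT φ), fun _ => rfl⟩, reduction prog, q,
    fun φ => ?_, fun φ => ?_⟩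
  · have hm : φ.numVars + 1 ≥ 1 := Nat.succ_pos _
    obtain ⟨t, ht, e, he, he'⟩ := hout (φ.numVars + 1) hm
    -- The extra 1 is paid for by the end marker of the matrix.
    have hlen : φ.numVars + 1 ≤ φ.encode.length := by
      have h1 : φ.encode.length = (encList Quantifier.encode (List.ofFn φ.quant)).length +
        (encList CAtom.encode φ.matrix).length := List.length_append
      have h2 := length_le_length_encList Quantifier.encode (List.ofFn φ.quant)
      rw [encList_eq_flatMap CAtom.encode, List.length_append, List.length_singleton] at h1
      rw [List.length_ofFn] at h2
      omega
    have ht' : t ≤ (p'.comp p).eval φ.encode.length := by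
      rw [Polynomial.eval_comp]
      exact ht.trans (p'.eval_mono_nat ((hp _ hm).trans (p.eval_mono_nat hlen)))
    change OutputsWithin _ φ.encode (targetSentence φ C (T φ) (hT φ)).encode
      (q.eval φ.encode.length)
    rw [hq]
    exact outputsWithin_reduction φ he he' (by omega) (List.ofFn_get _).symm (hT φ)
  · refine (holds_iff_exists_assignment φ (T φ) ?_).trans (holds_targetSentence φ C (T φ) _).symm
    have hc : 0 < Fintype.card A := Fintype.card_pos
    -- The generated tuple lists all elements of the domain in each block, so position `a` of block
    -- `i` carries `a`. Reading generator `l` at that position gives the function `s l i a` required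
    -- of the family, and projectivity puts every choice of positions into an adversary of `Ω
    -- (φ.numVars + 1)`.
    obtain ⟨k, f, s, hf, hs, hfs⟩ := hgen ((φ.numVars + 1) * Fintype.card A)
      (Nat.mul_pos (Nat.succ_pos _) hc)
      (fun j => (Fintype.equivFin A).symm (finProdFinEquiv.symm j).2) (Set.mem_univ _)
    refine ⟨k, f, fun l i a => s l (finProdFinEquiv (i, Fintype.equivFin A a)), hf,
      fun i a => by simp [hfs], fun j x => ?_⟩
    obtain ⟨B, hB, hsB⟩ := hs j
    obtain ⟨B', hB', h⟩ := hproj _ (Nat.succ_pos _) B hB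
    exact List.get_of_mem ((hmem _ (Nat.succ_pos _) _).2
      ⟨B', hB', h (fun i => Fintype.equivFin A (x i)) _ hsB⟩)

end

theorem ConstraintLanguage.withConstants_univ {A : Type} {L : ConstraintLanguage A}
    (h : L.consts = Set.univ) : L.withConstants Set.univ = L := by
  cases L
  subst h
  simp [ConstraintLanguage.withConstants]

theorem mainTheorem7 {A : Type} [Fintype A] (L : ConstraintLanguage A)
    (Ω : (m : ℕ) → Finset (Adversary A m))
    (hnondeg : ∀ m ≥ 1, Nondegenerate (Ω m))
    (heff : Effective Ω)
    (hproj : Projective Ω)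
    (hpoly : PolynomiallyBounded Ω)
    (hgen : ∀ m ≥ 1, Generates L (Ω m) Set.univ) :
    (∀ C : Set A, (∀ m ≥ 1, ∀ B ∈ Ω m, ∀ t ∈ B, ∀ i, t i ∈ L.consts ∪ C) →
      (QCSP L).PolyReducesTo (CSP (L.withConstants C))) ∧
    (L.consts = Set.univ → (QCSPc L).PolyReducesTo (CSPc L)) := by
  have main : ∀ C : Set A, (∀ m ≥ 1, ∀ B ∈ Ω m, ∀ t ∈ B, ∀ i, t i ∈ L.consts ∪ C) →
      (QCSP L).PolyReducesTo (CSP (L.withConstants C)) := fun C hC =>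
    polyReducesTo_of_generates hnondeg heff hproj hpoly hgen hC
  refine ⟨main, fun h => ?_⟩
  -- If all elements are already named, adding all constants does not change the language, so both
  -- problems with constants are those of `L` itself.
  have := main Set.univ fun _ _ _ _ _ _ _ => Or.inr (Set.mem_univ _)
  rwa [QCSPc, CSPc, ConstraintLanguage.withConstants_univ h] at *
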